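/- Let $m\ge 2$ and let $H=\mathrm{SL}_m\mathbb R/\mathrm{SO}(m)$ with its invariant Riemannian metric. The visual sphere $\partial_\infty H$ is the set of asymptote classes of geodesic rays, identified, with its topology, with the unit sphere of the tangent space at a base point (symmetric traceless matrices $Z$ with $\|Z\|=1$, where $Z$ represents the ray $t\mapsto e^{tZ}\mathrm{SO}(m)$). A point $g\,\mathrm{SO}(m)\in H$ determines the inner product $\langle u,v\rangle=(g^{-1}u)\cdot(g^{-1}v)$ on $\mathbb R^m$. For a direct sum decomposition $\mathbb R^m=U_1\oplus\dots\oplus U_r$ the points of $H$ whose inner product makes the $U_i$ pairwise orthogonal form a totally geodesic copy of $\mathbb R^{r-1}\times\prod_i \mathrm{SL}(U_i)/\mathrm{SO}(U_i)$; let $S(U_1,\dots,U_r)\subset\partial_\infty H$ be its boundary sphere, i.e. the set of points at infinity represented by geodesic rays contained in it. Two subspheres $A,B\subset \partial_\infty H$ of complementary dimensions ($\dim A+\dim B=\dim\partial_\infty H-1$) are said to link if they are disjoint and $A$ cannot be contracted to a point in $\partial_\infty H\setminus B$. (For the spheres below this is equivalent to their linking number being non-zero, and it is symmetric in $A$ and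 $B$.) **Proposition.** Let $L_1,\dots,L_m,L$ be points of $\mathbb P^{m-1}=\mathbb P(\mathbb R^m)$ and let $P\subset\mathbb P^{m-1}$ be a hyperplane, in general position: any $m$ of the points $L_1,\dots,L_m,L$ span $\mathbb P^{m-1}$, and none of these $m+1$ points lies on $P$. Let $V_i$ be the hyperplane spanned by all the points $L_1,\dots,L_m$ except $L_i$. Then: 1. Each connected component of $\mathbb P^{m-1}\setminus(V_1\cup\dots\cup V_m)$ is an open $(m-1)$-simplex with vertices $L_1,\dots,L_m$, i.e. of the form $\{[c_1w_1+\dots+c_mw_m] : c_1,\dots,c_m>0\}$ for some non-zero vectors $w_i$ on the lines $L_i$. 2. Let $\sigma$ be the component that contains $L$. The spheres $S(L_1,\dots,L_m)$ and $S(L,P)$ are disjoint, and they link (equivalently in either order: the first is not contractible in the complement of the second; the second is not contractible in the complement of the first) if and only if $\sigma$ does not meet $P$. -/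

import Mathlib

open scoped LinearAlgebra.Projectivization

noncomputable section

namespace SLSymm

/-! ### The symmetric space `SL_m(ℝ) / SO(m)` -/

/-- `SO(m)` as a subgroup of `SL_m(ℝ)`. -/
def SO (m : ℕ) : Subgroup (Matrix.SpecialLinearGroup (Fin m) ℝ) where
  carrier := {k | (k : Matrix (Fin m) (Fin m) ℝ) * (k : Matrix (Fin m) (Fin m) ℝ).transpose = 1}
  one_mem' := by simp
  mul_mem' := by
    intro a b ha hb
    simp only [Set.mem_ofPred_eq, Matrix.SpecialLinearGroup.coe_mul, Matrix.transpose_mul] at *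
    rw [Matrix.mul_assoc, ← Matrix.mul_assoc (b : Matrix (Fin m) (Fin m) ℝ), hb, Matrix.one_mul, ha]
  inv_mem' := by
    intro a ha
    simp only [Set.mem_ofPred_eq] at *
    have h1 : (a : Matrix (Fin m) (Fin m) ℝ) *
        ((a⁻¹ : Matrix.SpecialLinearGroup (Fin m) ℝ) : Matrix (Fin m) (Fin m) ℝ) = 1 := by
      rw [← Matrix.SpecialLinearGroup.coe_mul, mul_inv_cancel]; simp
    have h2 : ((a⁻¹ : Matrix.SpecialLinearGroup (Fin m) ℝ) : Matrix (Fin m) (Fin m) ℝ) =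
        (a : Matrix (Fin m) (Fin m) ℝ).transpose :=
      (left_inv_eq_right_inv (mul_eq_one_comm.mp h1) ha)
    rw [h2, Matrix.transpose_transpose]
    exact mul_eq_one_comm.mp ha

/-- The symmetric space `SL_m(ℝ) / SO(m)`. -/
abbrev SymSpace (m : ℕ) : Type := Matrix.SpecialLinearGroup (Fin m) ℝ ⧸ SO m

/-- The positive definite symmetric matrix `g gᵀ` attached to the point `g SO(m)`. -/
def gram {m : ℕ} (p : SymSpace m) : Matrix (Fin m) (Fin m) ℝ :=
  Quotient.liftOn p
    (fun g => (g : Matrix (Fin m) (Fin m) ℝ) * (g : Matrix (Fin m) (Fin m) ℝ).transpose)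
    (by
      intro a b hab
      have h : a⁻¹ * b ∈ SO m := QuotientGroup.leftRel_apply.mp hab
      have hb : b = a * (a⁻¹ * b) := by group
      have h' : ((a⁻¹ * b : Matrix.SpecialLinearGroup (Fin m) ℝ) : Matrix (Fin m) (Fin m) ℝ) *
        ((a⁻¹ * b : Matrix.SpecialLinearGroup (Fin m) ℝ) :
          Matrix (Fin m) (Fin m) ℝ).transpose = 1 := h
      change _ = (b : Matrix (Fin m) (Fin m) ℝ) * (b : Matrix (Fin m) (Fin m) ℝ).transpose
      rw [hb, Matrix.SpecialLinearGroup.coe_mul a (a⁻¹ * b), Matrix.transpose_mul,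
        Matrix.mul_assoc, ← Matrix.mul_assoc _ _ (a : Matrix (Fin m) (Fin m) ℝ).transpose, h',
        Matrix.one_mul])

/-- The inner product on `ℝ^m` attached to a point of the symmetric space: at `g SO(m)` it is
`⟨u, v⟩ = (g⁻¹ u) ⬝ (g⁻¹ v) = uᵀ (g gᵀ)⁻¹ v`. -/
def innerAt {m : ℕ} (p : SymSpace m) (u v : Fin m → ℝ) : ℝ :=
  u ⬝ᵥ ((gram p)⁻¹.mulVec v)

/-- The `SL_m(ℝ)`-invariant Riemannian distance, normalised so that `t ↦ exp(tZ) SO(m)` has unit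
speed when `Z` is symmetric, traceless and of Frobenius norm one:
`d(p, q)² = ∑ (½ log λ)²` over the (positive) eigenvalues `λ` of `(gram p)⁻¹ (gram q)`, with
multiplicity.  Equivalently, `d(g SO(m), h SO(m))² = ∑ (log s)²` over the singular values `s` of
`g⁻¹ h`. -/
def sdist {m : ℕ} (p q : SymSpace m) : ℝ :=
  Real.sqrt ((((gram p)⁻¹ * gram q).charpoly.roots.map fun l => (Real.log l / 2) ^ 2).sum)

/-! ### Geodesic rays and the visual sphere -/

/-- The visual sphere of `SL_m(ℝ) / SO(m)`: the unit sphere, with its usual topology, in the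
tangent space at the base point `o = 1 · SO(m)`, that is, the symmetric traceless matrices of
Frobenius norm one.  The direction `Z` stands for the asymptote class of the geodesic ray
`t ↦ exp(tZ) · o`; every asymptote class contains exactly one ray issuing from `o`. -/
abbrev VisualSphere (m : ℕ) : Type :=
  {Z : Matrix (Fin m) (Fin m) ℝ // Z.IsSymm ∧ Z.trace = 0 ∧ ∑ i, ∑ j, Z i j ^ 2 = 1}

theorem det_exp_of_isSymm {m : ℕ} (A : Matrix (Fin m) (Fin m) ℝ) (hA : A.IsSymm)
    (htr : A.trace = 0) : (NormedSpace.exp A).det = 1 := by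
  have hH : A.IsHermitian := by
    rw [Matrix.IsHermitian, Matrix.conjTranspose_eq_transpose_of_trivial]; exact hA
  have hsp := hH.spectral_theorem
  have hsum : ∑ i, hH.eigenvalues i = 0 := by
    have := hH.trace_eq_sum_eigenvalues
    rw [htr] at this
    simpa using this.symm
  rw [Unitary.conjStarAlgAut_apply] at hsp
  set U : Matrix (Fin m) (Fin m) ℝ := (hH.eigenvectorUnitary : Matrix (Fin m) (Fin m) ℝ) with hU
  have hUU : U * star U = 1 := Unitary.coe_mul_star_self hH.eigenvectorUnitary
  have hinv : U⁻¹ = star U := Matrix.inv_eq_right_inv hUU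
  have hu : IsUnit U := (Matrix.isUnit_iff_isUnit_det U).mpr (Matrix.isUnit_det_of_right_inverse hUU)
  rw [hsp, ← hinv, Matrix.exp_conj U _ hu, Matrix.det_conj hu, Matrix.exp_diagonal,
    Matrix.det_diagonal]
  have : ∀ i, NormedSpace.exp ((RCLike.ofReal : ℝ → ℝ) ∘ hH.eigenvalues) i =
      Real.exp (hH.eigenvalues i) := by
    intro i
    rw [Pi.coe_exp, Real.exp_eq_exp_ℝ]
    rfl
  rw [Finset.prod_congr rfl (fun i _ => this i), ← Real.exp_sum, hsum, Real.exp_zero]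

/-- `exp(tZ)` as an element of `SL_m(ℝ)`. -/
def expSL {m : ℕ} (Z : VisualSphere m) (t : ℝ) : Matrix.SpecialLinearGroup (Fin m) ℝ :=
  ⟨NormedSpace.exp (t • Z.1),
    det_exp_of_isSymm _ (by simp [Matrix.IsSymm, Z.2.1.eq]) (by simp [Z.2.2.1])⟩

/-- The unit speed geodesic `t ↦ g exp(tZ) SO(m)`; for `t ≥ 0` these are all the geodesic rays of
the symmetric space. -/
def geodesic {m : ℕ} (g : Matrix.SpecialLinearGroup (Fin m) ℝ) (Z : VisualSphere m) (t : ℝ) :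
    SymSpace m :=
  QuotientGroup.mk (g * expSL Z t)

/-- Two geodesic rays are asymptotic if they stay at bounded distance. -/
def Asymptotic {m : ℕ} (γ δ : ℝ → SymSpace m) : Prop :=
  ∃ C : ℝ, ∀ t : ℝ, 0 ≤ t → sdist (γ t) (δ t) ≤ C

/-- The boundary at infinity of a subset `Y` of the symmetric space: the points at infinity
represented by geodesic rays that lie in `Y`. -/
def boundaryAtInfinity {m : ℕ} (Y : Set (SymSpace m)) : Set (VisualSphere m) :=
  {ξ | ∃ (g : Matrix.SpecialLinearGroup (Fin m) ℝ) (Z : VisualSphere m),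
    (∀ t : ℝ, 0 ≤ t → geodesic g Z t ∈ Y) ∧ Asymptotic (geodesic g Z) (geodesic 1 ξ)}

/-- The totally geodesic symmetric subspace of a direct sum decomposition `ℝ^m = ⨁ U_i`: the points
whose inner product makes the summands pairwise orthogonal.  It is the orbit of any one of its
points under the subgroup of `SL_m(ℝ)` preserving every `U_i`, and is a copy of
`ℝ^(r-1) × ∏ SL(U_i)/SO(U_i)`. -/
def symSubspace {m : ℕ} {ι : Type} (U : ι → Submodule ℝ (Fin m → ℝ)) : Set (SymSpace m) :=
  {p | Pairwise fun i j => ∀ u ∈ U i, ∀ v ∈ U j, innerAt p u v = 0}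

/-- The sphere at infinity `S(U_1, …, U_r)` of a direct sum decomposition. -/
def sphereAtInfinity {m : ℕ} {ι : Type} (U : ι → Submodule ℝ (Fin m → ℝ)) :
    Set (VisualSphere m) :=
  boundaryAtInfinity (symSubspace U)

/-! ### Linking -/

/-- `A` can be contracted to a point inside `C`. -/
def ContractsIn {X : Type*} [TopologicalSpace X] (A C : Set X) : Prop :=
  ∃ h : A ⊆ C, ContinuousMap.Nullhomotopic
    (⟨Set.inclusion h, continuous_inclusion h⟩ : C(A, C))

/-- `A` links `B`: they are disjoint and `A` cannot be contracted to a point in the complement of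
`B`.  For a `p`-sphere `A` and an unknotted `q`-sphere `B` in a `(p+q+1)`-sphere the complement of
`B` has the homotopy type of a `p`-sphere, so this says that the linking number is not zero. -/
def Links {X : Type*} [TopologicalSpace X] (A B : Set X) : Prop :=
  Disjoint A B ∧ ¬ ContractsIn A Bᶜ

/-! ### Projective space -/

/-- The usual (quotient) topology of real projective space. -/
instance projTopology (m : ℕ) : TopologicalSpace (ℙ ℝ (Fin m → ℝ)) :=
  TopologicalSpace.coinduced (Projectivization.mk' ℝ (V := Fin m → ℝ)) inferInstance

/-- The set of points of the projective subspace given by a linear subspace. -/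
def projPoints {m : ℕ} (W : Submodule ℝ (Fin m → ℝ)) : Set (ℙ ℝ (Fin m → ℝ)) :=
  {x | x.submodule ≤ W}

/-- The projective subspace `V_i` spanned by all the points `L_j` except `L_i`. -/
def faceHyperplane {m : ℕ} (Ls : Fin m → ℙ ℝ (Fin m → ℝ)) (i : Fin m) :
    Submodule ℝ (Fin m → ℝ) :=
  ⨆ (j : Fin m) (_ : j ≠ i), (Ls j).submodule

/-- The complement in projective space of the union of the hyperplanes `V_i`. -/
def faceComplement {m : ℕ} (Ls : Fin m → ℙ ℝ (Fin m → ℝ)) : Set (ℙ ℝ (Fin m → ℝ)) :=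
  (⋃ i, projPoints (faceHyperplane Ls i))ᶜ

/-- `σ` is an open projective `(m-1)`-simplex with vertices `L_1, …, L_m`: for some linearly
independent vectors `w_i` on the lines `L_i`, it consists of the points
`[c_1 w_1 + ⋯ + c_m w_m]` with all `c_i > 0`. -/
def IsOpenSimplex {m : ℕ} (Ls : Fin m → ℙ ℝ (Fin m → ℝ)) (σ : Set (ℙ ℝ (Fin m → ℝ))) : Prop :=
  ∃ w : Fin m → (Fin m → ℝ), LinearIndependent ℝ w ∧ (∀ i, w i ∈ (Ls i).submodule) ∧
    σ = {x | ∃ c : Fin m → ℝ, (∀ i, 0 < c i) ∧ ∑ i, c i • w i ∈ x.submodule}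

/-- General position of the points `L_1, …, L_m`, the point `L` and the hyperplane `P`: any `m` of
the `m + 1` points span projective space, and none of the `m + 1` points lies on `P`. -/
structure GeneralPosition {m : ℕ} (Ls : Fin m → ℙ ℝ (Fin m → ℝ)) (L : ℙ ℝ (Fin m → ℝ))
    (P : Submodule ℝ (Fin m → ℝ)) : Prop where
  independent : Projectivization.Independent Ls
  notMem_face : ∀ i, L ∉ projPoints (faceHyperplane Ls i)
  vertex_notMem : ∀ i, Ls i ∉ projPoints P
  notMem : L ∉ projPoints P

end SLSymm

end

/-! ### Nonvanishing perturbations of the identity do not exist -/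

/-! `SL_m(ℝ)` acts on the visual sphere by homeomorphisms that carry the spheres of a decomposition
to those of the translated decomposition (`translateHomeo`, `sphereAtInfinity_map`). Choose a basis
`b` on the lines `L_i` whose sum spans `L`, and a linear form `f` with kernel `P`. A translation
then turns the `L_i` into the coordinate axes, `L` into the line of a vector `l` and `P` into `φ^⊥`,
where `|l i| = |φ i|` and `l i * φ i` is a positive multiple of `f (b i)`
(`exists_adapted_translate`). The component of `L` is the open simplex of `b`, and it misses `P`
exactly when all `f (b i)` have the same sign. So linking has to be matched with constancy of the
sign of `l i * φ i` (`links_normal_form`).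

The first sphere is now the set of diagonal directions. For the second, a ray along which `l` stays
orthogonal to `φ^⊥` has `l` and `φ`, pulled back, as eigenvectors of its direction for one
eigenvalue `c`. Comparing exponential growth along asymptotic rays, the limit `ξ` has Rayleigh
quotient at least `c` at `l` and at most `c` at `φ` (`RayAsymptotic.rayleigh_of_orthogonal`).

If the signs agree, then `φ = ±l` and the second sphere consists of the directions with eigenvector
`l`. The two spheres are the unit spheres of complementary linear subspaces, the image and the
kernel of `diagProjection`. A contraction of one off the other would yield a nowhere vanishing map
equal to the identity off a compact set (`not_contractsIn_of_projection`), which the no-retraction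
theorem forbids (`no_nonvanishing`).

If the signs differ, the form `M ↦ φᵀMφ - lᵀMl` vanishes on the first sphere, is nonpositive on the
second, and is positive at `φφᵀ - llᵀ` by strict Cauchy-Schwarz. Straight lines towards this matrix,
or towards its negative, contract either sphere off the other (`contractsIn_of_opposite_signs`).

The no-retraction theorem itself is proved by integration: the integral of `det (1 + t A)` over the
ball is polynomial in `t` and constant for small `t`, so at `t = 1` it is the volume of the ball,
whereas a retraction onto the sphere has singular derivative everywhere. -/

namespace NoRetraction

open MeasureTheory Metric Set

/-! ### Lipschitz perturbations of the identity supported in a ball. -/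

section Extension

variable {E : Type*} [NormedAddCommGroup E] [NormedSpace ℝ E]

/-- Extension by zero of a Lipschitz function on a closed ball that vanishes on its boundary. -/
theorem lipschitzWith_extend_zero {u : E → E} {R : ℝ} {K : NNReal}
    (hu : LipschitzOnWith K u (closedBall 0 R)) (h0 : ∀ x, ‖x‖ = R → u x = 0) :
    LipschitzWith K (fun x => open Classical in if ‖x‖ ≤ R then u x else 0) := by
  have key : ∀ x y : E, ‖x‖ ≤ R → R < ‖y‖ → ‖u x‖ ≤ K * ‖x - y‖ := by
    intro x y hx hy
    -- The segment from `x` to `y` crosses the sphere of radius `R`, where `u` vanishes; the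
    -- Lipschitz bound up to the crossing point is enough.
    have hc : ContinuousOn (fun s : ℝ => ‖x + s • (y - x)‖) (Icc 0 1) := by fun_prop
    have hR : R ∈ Icc ((fun s : ℝ => ‖x + s • (y - x)‖) 0) ((fun s : ℝ => ‖x + s • (y - x)‖) 1) := by
      simp [hx, hy.le]
    obtain ⟨s, hs, hsR⟩ := intermediate_value_Icc zero_le_one hc hR
    have h1 := hu.norm_sub_le (x := x) (y := x + s • (y - x)) (by simpa using hx)
      (by simpa using hsR.le)
    rw [h0 _ hsR, sub_zero] at h1
    refine h1.trans ?_
    have h2 : ‖x - (x + s • (y - x))‖ = s * ‖x - y‖ := by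
      rw [sub_add_cancel_left, norm_neg, norm_smul, Real.norm_of_nonneg hs.1, norm_sub_rev]
    rw [h2]
    have := mul_le_of_le_one_left (norm_nonneg (x - y)) hs.2
    gcongr
  refine LipschitzWith.of_dist_le_mul fun x y => ?_
  rw [dist_eq_norm, dist_eq_norm]
  by_cases hx : ‖x‖ ≤ R <;> by_cases hy : ‖y‖ ≤ R
  · simpa [hx, hy] using hu.norm_sub_le (by simpa using hx) (by simpa using hy)
  · simpa [hx, hy] using key x y hx (not_le.mp hy)
  · simpa [hx, hy, norm_sub_rev x y] using key y x hy (not_le.mp hx)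
  · simp only [hx, hy, if_false, sub_zero, norm_zero]
    positivity

variable [CompleteSpace E]

/-- A small Lipschitz perturbation of the identity supported in a ball permutes the ball. -/
theorem bijOn_ball_of_lipschitz {v : E → E} {R : ℝ} {K : NNReal} (hv : LipschitzWith K v)
    (h0 : ∀ x, R ≤ ‖x‖ → v x = 0) {t : ℝ} (ht : 0 ≤ t) (htK : t * K < 1) :
    InjOn (fun x => x + t • v x) (ball 0 R) ∧ (fun x => x + t • v x) '' ball 0 R = ball 0 R := by
  have hinj : Function.Injective fun x => x + t • v x := by
    intro x y hxy
    have h1 : x - y = t • (v y - v x) := by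
      simp only at hxy
      rw [smul_sub, sub_eq_sub_iff_add_eq_add, hxy, add_comm]
    have h2 : ‖x - y‖ ≤ t * K * ‖x - y‖ := by
      calc ‖x - y‖ = t * ‖v y - v x‖ := by rw [h1, norm_smul, Real.norm_of_nonneg ht]
        _ ≤ t * (K * ‖y - x‖) := by gcongr; exact hv.norm_sub_le y x
        _ = _ := by rw [norm_sub_rev]; ring
    have h3 : ‖x - y‖ = 0 := by
      by_contra h
      have : 0 < ‖x - y‖ := lt_of_le_of_ne (norm_nonneg _) (Ne.symm h)
      nlinarith
    exact sub_eq_zero.mp (norm_eq_zero.mp h3)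
  have hsurj : Function.Surjective fun x => x + t • v x := by
    intro y
    -- Preimages of `y` are the fixed points of this contraction.
    have hc : ContractingWith (t.toNNReal * K) fun x => y - t • v x := by
      constructor
      · rw [← NNReal.coe_lt_coe]; simpa [ht] using htK
      · refine LipschitzWith.of_dist_le_mul fun a b => ?_
        rw [dist_eq_norm, dist_eq_norm, sub_sub_sub_cancel_left, ← smul_sub, norm_smul,
          Real.norm_of_nonneg ht]
        have := hv.norm_sub_le b a
        rw [norm_sub_rev b a] at this
        simp only [NNReal.coe_mul, Real.coe_toNNReal _ ht, mul_assoc]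
        gcongr
    have := hc.fixedPoint_isFixedPt
    refine ⟨hc.fixedPoint, ?_⟩
    have h : y - t • v hc.fixedPoint = hc.fixedPoint := this
    exact (sub_eq_iff_eq_add.mp h).symm
  refine ⟨hinj.injOn, ?_⟩
  ext y
  simp only [mem_image, mem_ball_zero_iff]
  constructor
  · rintro ⟨x, hx, rfl⟩
    -- An image point outside the open ball would itself be fixed by the map, so by injectivity it
    -- would equal `x`.
    by_contra hc
    have h1 := h0 _ (not_lt.mp hc)
    have h2 : x + t • v x = x := by
      apply hinj
      simp only
      rw [h1, smul_zero, add_zero]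
    rw [h2] at hc
    exact hc hx
  · intro hy
    obtain ⟨x, hx⟩ := hsurj y
    refine ⟨x, ?_, hx⟩
    by_contra hc
    have h1 := h0 _ (not_lt.mp hc)
    simp only [h1, smul_zero, add_zero] at hx
    exact hc (hx ▸ hy)

end Extension

/-! ### The polynomial `det (1 + t A)`. -/

section Determinant

variable {E : Type*} [NormedAddCommGroup E] [NormedSpace ℝ E] [FiniteDimensional ℝ E]

/-- `t ↦ det (1 + t A)` is a polynomial function of degree at most the dimension. -/
theorem det_one_add_eq_eval (A : E →L[ℝ] E) :
    ∃ p : Polynomial ℝ, p.natDegree ≤ Module.finrank ℝ E ∧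
      ∀ t : ℝ, (1 + t • A).det = p.eval t := by
  let b := Module.finBasis ℝ E
  let M := LinearMap.toMatrix b b (A : E →ₗ[ℝ] E)
  refine ⟨_, (Polynomial.natDegree_det_X_add_C_le M 1).trans (by simp), fun t => ?_⟩
  have h1 : (1 + t • A).det = (t • M + 1).det := by
    rw [ContinuousLinearMap.det, ← LinearMap.det_toMatrix b]
    congr 1
    have : ((1 + t • A : E →L[ℝ] E) : E →ₗ[ℝ] E) = t • (A : E →ₗ[ℝ] E) + LinearMap.id := by
      ext x; simp [add_comm]
    rw [this, map_add, map_smul, LinearMap.toMatrix_id]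
  rw [h1, ← Polynomial.coe_evalRingHom, RingHom.map_det]
  congr 1
  ext i j
  by_cases hij : i = j <;> simp [hij] <;> ring

/-- The value of `det (1 + t A)` at `t = 1` is a fixed affine combination of its values at
given nodes. -/
theorem exists_det_interpolation (ε : ℝ) (hε : 0 < ε) :
    ∃ (s : Finset ℝ) (w : ℝ → ℝ), (∀ t ∈ s, 0 < t ∧ t < ε) ∧ ∑ t ∈ s, w t = 1 ∧
      ∀ A : E →L[ℝ] E, (1 + A).det = ∑ t ∈ s, w t * (1 + t • A).det := by
  obtain ⟨s, hs, hcard⟩ := (Set.Ioo_infinite hε).exists_subset_card_eq (Module.finrank ℝ E + 1)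
  have hinj : Set.InjOn (id : ℝ → ℝ) (s : Set ℝ) := Function.injective_id.injOn
  -- The weights are the Lagrange basis polynomials at `1`. With `finrank + 1` nodes interpolation
  -- is exact for every `A`, so the weights do not depend on `A`.
  refine ⟨s, fun t => (Lagrange.basis s id t).eval 1, fun t ht => hs ht, ?_, fun A => ?_⟩
  · have h := Lagrange.sum_basis hinj (Finset.card_pos.mp (by omega))
    have := congrArg (Polynomial.eval 1) h
    simpa [Polynomial.eval_finsetSum] using this
  · obtain ⟨p, hp, hpe⟩ := det_one_add_eq_eval A
    have hdeg : p.degree < s.card := by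
      rw [hcard]
      exact (Polynomial.degree_le_of_natDegree_le hp).trans_lt (by exact_mod_cast Nat.lt_succ_self _)
    have h := congrArg (Polynomial.eval 1) (Lagrange.eq_interpolate hinj hdeg)
    have h1 := hpe 1
    rw [one_smul] at h1
    rw [h1, h, Lagrange.interpolate_apply, Polynomial.eval_finsetSum]
    refine Finset.sum_congr rfl fun t _ => ?_
    simp [hpe t, mul_comm]

/-- A kernel vector of `1 + s • A` with `0 ≤ s ≤ t` would satisfy `‖x‖ ≤ t * K * ‖x‖`. Hence the
determinant has no zero on `[0, t]`, and it starts at `1`. -/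
theorem det_one_add_pos {A : E →L[ℝ] E} {K t : ℝ} (hA : ‖A‖ ≤ K) (ht : 0 ≤ t) (htK : t * K < 1) :
    0 < (1 + t • A).det := by
  have hne : ∀ s ∈ Icc 0 t, (1 + s • A).det ≠ 0 := by
    intro s hs h0
    have := LinearMap.bot_lt_ker_of_det_eq_zero h0
    obtain ⟨x, hx, hx0⟩ := (Submodule.ne_bot_iff _).mp this.ne'
    have h1 : x + s • A x = 0 := by simpa using hx
    have h2 : ‖x‖ ≤ t * K * ‖x‖ := by
      calc ‖x‖ = ‖s • A x‖ := by rw [← norm_neg, neg_eq_of_add_eq_zero_right h1]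
        _ = s * ‖A x‖ := by rw [norm_smul, Real.norm_of_nonneg hs.1]
        _ ≤ t * (K * ‖x‖) := by
          have := (A.le_opNorm x).trans (mul_le_mul_of_nonneg_right hA (norm_nonneg x))
          have := hs.2
          gcongr
        _ = _ := by ring
    have : 0 < ‖x‖ := norm_pos_iff.mpr hx0
    nlinarith
  obtain ⟨p, -, hp⟩ := det_one_add_eq_eval A
  by_contra hneg
  have hc : ContinuousOn (fun s : ℝ => (1 + s • A).det) (Icc 0 t) := by
    simp_rw [hp]; exact p.continuous.continuousOn
  have h1 : (1 + (0 : ℝ) • A).det = 1 := by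
    rw [zero_smul, add_zero]; exact LinearMap.det_id
  obtain ⟨s, hs, hs0⟩ := intermediate_value_Icc' ht hc
    (show (0 : ℝ) ∈ Icc ((1 + t • A).det) ((1 + (0 : ℝ) • A).det) from
      ⟨not_lt.mp hneg, by rw [h1]; exact zero_le_one⟩)
  exact hne s hs hs0

end Determinant

/-! ### The no-retraction theorem. -/

section InnerProduct

variable {E : Type*} [NormedAddCommGroup E] [InnerProductSpace ℝ E] [FiniteDimensional ℝ E]

/-- There is no `C¹` retraction of a ball onto its boundary sphere. -/
theorem no_contDiff_retraction {f : E → E} {R : ℝ} (hR : 0 < R) (hf : ContDiff ℝ 1 f)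
    (hnorm : ∀ x, ‖f x‖ = R) (hid : ∀ x, ‖x‖ = R → f x = x) : False := by
  classical
  let _ : MeasurableSpace E := borel E
  have _ : BorelSpace E := ⟨rfl⟩
  set u : E → E := fun x => f x - x with hu
  have huC : ContDiff ℝ 1 u := hf.sub contDiff_id
  obtain ⟨K, hK⟩ := huC.contDiffOn.exists_lipschitzOnWith one_ne_zero (convex_closedBall (0 : E) R)
    (isCompact_closedBall 0 R)
  set v : E → E := fun x => if ‖x‖ ≤ R then u x else 0 with hv
  have hvL : LipschitzWith K v := lipschitzWith_extend_zero hK fun x hx => by simp [hu, hid x hx]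
  have hv0 : ∀ x, R ≤ ‖x‖ → v x = 0 := by
    intro x hx
    rcases hx.eq_or_lt with h | h
    · simp [hv, hu, h, hid x h.symm]
    · simp [hv, not_le.mpr h]
  have hvu : ∀ x ∈ ball (0 : E) R, v x = u x := by
    intro x hx
    simp [hv, (mem_ball_zero_iff.mp hx).le]
  set A : E → E →L[ℝ] E := fun x => fderiv ℝ u x with hA
  have hAK : ∀ x ∈ ball (0 : E) R, ‖A x‖ ≤ K := fun x hx =>
    norm_fderiv_le_of_lipschitzOn ℝ (isOpen_ball.mem_nhds hx) (hK.mono ball_subset_closedBall)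
  have hAcont : Continuous A := huC.continuous_fderiv one_ne_zero
  have hdetcont : ∀ t : ℝ, Continuous fun x => (1 + t • A x).det := fun t =>
    ContinuousLinearMap.continuous_det.comp (by fun_prop)
  have hint : ∀ t : ℝ, IntegrableOn (fun x => (1 + t • A x).det) (ball 0 R) := fun t =>
    ((hdetcont t).continuousOn.integrableOn_compact (isCompact_closedBall 0 R)).mono_set
      ball_subset_closedBall
  -- For small `t` the map `x + t • u x` permutes the ball and has positive Jacobian, so the change
  -- of variables formula gives the volume of the ball.
  have hvol : ∀ t : ℝ, 0 ≤ t → t * K < 1 →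
      ∫ x in ball (0 : E) R, (1 + t • A x).det = volume.real (ball (0 : E) R) := by
    intro t ht htK
    obtain ⟨hinj, himg⟩ := bijOn_ball_of_lipschitz hvL hv0 ht htK
    have hcongr : ∀ x ∈ ball (0 : E) R, x + t • v x = x + t • u x := fun x hx => by rw [hvu x hx]
    have hinj' : InjOn (fun x => x + t • u x) (ball 0 R) := hinj.congr hcongr
    have himg' : (fun x => x + t • u x) '' ball 0 R = ball 0 R := by
      rw [← image_congr hcongr, himg]
    have hder : ∀ x ∈ ball (0 : E) R,
        HasFDerivWithinAt (fun x => x + t • u x) (1 + t • A x) (ball 0 R) x := fun x _ =>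
      ((hasFDerivAt_id x).add
        ((huC.differentiable one_ne_zero x).hasFDerivAt.const_smul t)).hasFDerivWithinAt
    have h := integral_image_eq_integral_abs_det_fderiv_smul volume measurableSet_ball hder hinj'
      (fun _ => (1 : ℝ))
    rw [himg'] at h
    simp only [smul_eq_mul, mul_one, integral_const, MeasurableSet.univ, measureReal_restrict_apply,
      univ_inter] at h
    rw [h]
    refine setIntegral_congr_fun measurableSet_ball fun x hx => ?_
    exact (abs_of_pos (det_one_add_pos (hAK x hx) ht htK)).symm
  -- Nodes below `1 / (K + 1)` satisfy `t * K < 1`; as the weights sum to `1`, constancy of the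
  -- integral passes from the nodes to `t = 1`.
  obtain ⟨s, w, hs, hw, hdet⟩ := exists_det_interpolation (E := E) (1 / (K + 1)) (by positivity)
  have hone : ∫ x in ball (0 : E) R, (1 + A x).det = volume.real (ball (0 : E) R) := by
    rw [integral_congr_ae (.of_forall fun x => hdet (A x)), integral_finsetSum _ fun t _ => (hint t).const_mul _]
    have : ∀ t ∈ s, ∫ x in ball (0 : E) R, w t * (1 + t • A x).det =
        w t * volume.real (ball (0 : E) R) := by
      intro t ht
      rw [integral_const_mul, hvol t (hs t ht).1.le]
      have h := (hs t ht).2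
      rw [lt_div_iff₀ (by positivity)] at h
      nlinarith [(hs t ht).1]
    rw [Finset.sum_congr rfl this, ← Finset.sum_mul, hw, one_mul]
  have hzero : ∀ x, (1 + A x).det = 0 := by
    intro x
    by_contra hne
    have hder : HasFDerivAt f (1 + A x) x := by
      have h := (hasFDerivAt_id x).add (huC.differentiable one_ne_zero x).hasFDerivAt
      have hfe : f = id + u := by ext y; simp [hu]
      rw [hfe]
      exact h
    -- Since `‖f‖²` is constant, the image of the derivative is orthogonal to `f x`. An invertible
    -- derivative would have `f x` in its image, forcing `f x = 0`.
    have hsurj := (LinearMap.equivOfDetNeZero _ hne).surjective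
    obtain ⟨y, hy⟩ := hsurj (f x)
    have hy' : (1 + A x) y = f x := hy
    have h2 : HasFDerivAt (fun z => ‖f z‖ ^ 2) (2 • (innerSL ℝ (f x)).comp (1 + A x)) x := hder.norm_sq
    have h3 : (fun z => ‖f z‖ ^ 2) = fun _ => R ^ 2 := by ext z; rw [hnorm]
    rw [h3] at h2
    have h4 := congrArg (fun l : E →L[ℝ] ℝ => l y) (h2.unique (hasFDerivAt_const _ _))
    simp only [smul_apply, ContinuousLinearMap.comp_apply, hy',
      zero_apply, innerSL_apply_apply, real_inner_self_eq_norm_sq, hnorm, nsmul_eq_mul] at h4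
    have : 0 < R ^ 2 := by positivity
    norm_num at h4
    exact hR.ne' h4
  simp_rw [hzero] at hone
  have hpos : 0 < volume.real (ball (0 : E) R) :=
    ENNReal.toReal_pos (measure_ball_pos _ _ hR).ne' measure_ball_lt_top.ne
  simp at hone
  linarith [hone.symm ▸ hpos]

/-- A `C¹` approximation with error below `‖F x‖` still has no zero, and it can be kept equal to `F`
outside a larger ball. Rescaling its values to norm `R` gives a `C¹` retraction onto the sphere. -/
theorem no_nonvanishing_of_inner {F : E → E} (hF : Continuous F) (h0 : ∀ x, F x ≠ 0) {r : ℝ}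
    (hid : ∀ x, r ≤ ‖x‖ → F x = x) : False := by
  set R : ℝ := |r| + 1 with hR
  have hRpos : 0 < R := by positivity
  have hrR : r < R := (le_abs_self r).trans_lt (lt_add_one _)
  have hS : IsClosed {x : E | R ≤ ‖x‖} := isClosed_le continuous_const continuous_norm
  have hU : {x : E | r < ‖x‖} ∈ nhdsSet {x : E | R ≤ ‖x‖} :=
    (isOpen_lt continuous_const continuous_norm).mem_nhdsSet.mpr fun x hx => hrR.trans_le hx
  obtain ⟨g, hg, hgF, hgS, -⟩ := hF.exists_contDiff_approx_and_eqOn 1 hF.norm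
    (fun x => norm_pos_iff.mpr (h0 x)) hS hU
    (contDiffOn_id.congr fun x hx => hid x (le_of_lt hx))
  have hg0 : ∀ x, g x ≠ 0 := by
    intro x hx
    have := hgF x
    rw [hx, dist_zero_left] at this
    exact lt_irrefl _ this
  refine no_contDiff_retraction (f := fun x => (R / ‖g x‖) • g x) hRpos ?_ ?_ ?_
  · have hg' : ContDiff ℝ 1 g := hg
    exact (contDiff_const.div (hg'.norm ℝ hg0) fun x => norm_ne_zero_iff.mpr (hg0 x)).smul hg'
  · intro x
    rw [norm_smul, norm_div, norm_norm, div_mul_cancel₀ _ (norm_ne_zero_iff.mpr (hg0 x)),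
      Real.norm_of_nonneg hRpos.le]
  · intro x hx
    have h1 : g x = x := (hgS hx.ge).trans (hid x (hrR.le.trans hx.ge))
    simp only [h1, hx, div_self hRpos.ne', one_smul]

end InnerProduct

/-- A nowhere vanishing continuous self-map of a finite dimensional real vector space cannot agree
with the identity off a compact set. -/
theorem no_nonvanishing {V : Type*} [AddCommGroup V] [Module ℝ V] [TopologicalSpace V]
    [IsTopologicalAddGroup V] [ContinuousSMul ℝ V] [T2Space V] [FiniteDimensional ℝ V]
    {F : V → V} (hF : Continuous F) (h0 : ∀ x, F x ≠ 0) {K : Set V} (hK : IsCompact K)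
    (hid : ∀ x ∉ K, F x = x) : False := by
  let e : V ≃L[ℝ] EuclideanSpace ℝ (Fin (Module.finrank ℝ V)) :=
    ContinuousLinearEquiv.ofFinrankEq (by simp)
  obtain ⟨r, hr⟩ := (hK.image e.continuous).isBounded.exists_norm_le
  refine no_nonvanishing_of_inner (F := fun x => e (F (e.symm x))) (r := r + 1)
    (e.continuous.comp (hF.comp e.symm.continuous)) (fun x => by simpa using h0 _) fun x hx => ?_
  rw [hid, e.apply_symm_apply]
  intro hmem
  have := hr x ⟨_, hmem, e.apply_symm_apply x⟩
  linarith

end NoRetraction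

namespace SLSymm

/-! ### Contractions as homotopies -/

section Homotopy

variable {X : Type*} [TopologicalSpace X] {A C : Set X}

theorem ContractsIn.exists_homotopy (h : ContractsIn A C) :
    ∃ (H : unitInterval × A → X) (y : X), Continuous H ∧ y ∈ C ∧ (∀ p, H p ∈ C) ∧
      (∀ a, H (0, a) = a) ∧ ∀ a, H (1, a) = y := by
  obtain ⟨hAC, y, ⟨G⟩⟩ := h
  refine ⟨fun p => (G p : C), y, continuous_subtype_val.comp G.continuous, y.2,
    fun p => (G p).2, fun a => ?_, fun a => ?_⟩
  · exact congrArg Subtype.val (G.apply_zero a)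
  · exact congrArg Subtype.val (G.apply_one a)

theorem contractsIn_of_homotopy {H : unitInterval × A → X} {y : X} (hH : Continuous H) (hy : y ∈ C)
    (hC : ∀ p, H p ∈ C) (h0 : ∀ a, H (0, a) = a) (h1 : ∀ a, H (1, a) = y) : ContractsIn A C := by
  refine ⟨fun a ha => (congrArg (· ∈ C) (h0 ⟨a, ha⟩)).mp (hC (0, ⟨a, ha⟩)), ⟨y, hy⟩, ⟨⟨⟨fun p => ⟨H p, hC p⟩,
    hH.subtype_mk _⟩, fun a => ?_, fun a => ?_⟩⟩⟩
  · exact Subtype.ext (h0 a)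
  · exact Subtype.ext (h1 a)

theorem ContractsIn.image {Y : Type*} [TopologicalSpace Y] (e : X ≃ₜ Y) (h : ContractsIn A C) :
    ContractsIn (e '' A) (e '' C) := by
  obtain ⟨H, y, hH, hy, hC, h0, h1⟩ := h.exists_homotopy
  have hmem : ∀ b : e '' A, e.symm b ∈ A := by
    rintro ⟨_, a, ha, rfl⟩; simpa using ha
  refine contractsIn_of_homotopy (H := fun p => e (H (p.1, ⟨e.symm p.2, hmem p.2⟩))) (y := e y)
    ?_ ⟨y, hy, rfl⟩ (fun p => ⟨_, hC _, rfl⟩) (fun b => ?_) (fun b => ?_)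
  · refine e.continuous.comp (hH.comp (continuous_fst.prodMk (Continuous.subtype_mk ?_ _)))
    exact e.symm.continuous.comp (continuous_subtype_val.comp continuous_snd)
  · simp only [h0, e.apply_symm_apply]
  · simp only [h1]

theorem Links.image {Y : Type*} [TopologicalSpace Y] (e : X ≃ₜ Y) {B : Set X} (h : Links A B) :
    Links (e '' A) (e '' B) := by
  refine ⟨(Set.disjoint_image_iff e.injective).mpr h.1, fun hc => h.2 ?_⟩
  have := hc.image e.symm
  rw [← Set.image_compl_eq e.bijective] at this
  simpa [Set.image_image] using this

theorem links_image_iff {Y : Type*} [TopologicalSpace Y] (e : X ≃ₜ Y) {B : Set X} :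
    Links (e '' A) (e '' B) ↔ Links A B := by
  refine ⟨fun h => ?_, Links.image e⟩
  simpa [Set.image_image] using h.image e.symm

end Homotopy

/-! ### Complementary linear subspheres -/

variable {m : ℕ}

/-- The square of the Frobenius norm. -/
def frobSq (M : Matrix (Fin m) (Fin m) ℝ) : ℝ := ∑ i, ∑ j, M i j ^ 2

theorem continuous_frobSq : Continuous (frobSq (m := m)) := by
  unfold frobSq; fun_prop

theorem frobSq_nonneg (M : Matrix (Fin m) (Fin m) ℝ) : 0 ≤ frobSq M :=
  Finset.sum_nonneg fun _ _ => Finset.sum_nonneg fun _ _ => sq_nonneg _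

theorem sq_le_frobSq (M : Matrix (Fin m) (Fin m) ℝ) (i j : Fin m) : M i j ^ 2 ≤ frobSq M :=
  (Finset.single_le_sum (f := fun j => M i j ^ 2) (fun _ _ => sq_nonneg _) (Finset.mem_univ j)).trans
    (Finset.single_le_sum (f := fun i => ∑ j, M i j ^ 2)
      (fun _ _ => Finset.sum_nonneg fun _ _ => sq_nonneg _) (Finset.mem_univ i))

theorem frobSq_smul (c : ℝ) (M : Matrix (Fin m) (Fin m) ℝ) : frobSq (c • M) = c ^ 2 * frobSq M := by
  simp [frobSq, mul_pow, Finset.mul_sum]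

theorem frobSq_eq_zero {M : Matrix (Fin m) (Fin m) ℝ} : frobSq M = 0 ↔ M = 0 := by
  refine ⟨fun h => ?_, fun h => by simp [h, frobSq]⟩
  ext i j
  have := sq_le_frobSq M i j
  rw [h] at this
  exact pow_eq_zero_iff two_ne_zero |>.mp (le_antisymm this (sq_nonneg _))

theorem isCompact_frobSq_le (c : ℝ) : IsCompact {M : Matrix (Fin m) (Fin m) ℝ | frobSq M ≤ c} := by
  have h : IsCompact (Set.univ.pi fun _ => Set.univ.pi fun _ => Set.Icc (-√c) √c :
      Set (Matrix (Fin m) (Fin m) ℝ)) :=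
    isCompact_univ_pi fun _ => isCompact_univ_pi fun _ => isCompact_Icc
  refine h.of_isClosed_subset (isClosed_le continuous_frobSq continuous_const) ?_
  intro M hM i _ j _
  exact abs_le.mp (Real.abs_le_sqrt ((sq_le_frobSq M i j).trans hM))

/-- The symmetric traceless matrices. -/
def symTraceless (m : ℕ) : Submodule ℝ (Matrix (Fin m) (Fin m) ℝ) where
  carrier := {Z | Z.IsSymm ∧ Z.trace = 0}
  add_mem' := fun ha hb => ⟨ha.1.add hb.1, by rw [Matrix.trace_add, ha.2, hb.2, add_zero]⟩
  zero_mem' := ⟨Matrix.isSymm_zero, Matrix.trace_zero _ _⟩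
  smul_mem' := fun c _ ha => ⟨ha.1.smul c, by rw [Matrix.trace_smul, ha.2, smul_zero]⟩

theorem VisualSphere.mem_symTraceless (Z : VisualSphere m) : Z.1 ∈ symTraceless m := ⟨Z.2.1, Z.2.2.1⟩

theorem VisualSphere.frobSq_eq (Z : VisualSphere m) : frobSq Z.1 = 1 := Z.2.2.2

theorem VisualSphere.ne_zero (Z : VisualSphere m) : Z.1 ≠ 0 := fun h => by
  have := Z.frobSq_eq
  rw [frobSq_eq_zero.mpr h] at this
  exact zero_ne_one this

theorem frobSq_normalize {Z : Matrix (Fin m) (Fin m) ℝ} (h0 : Z ≠ 0) :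
    frobSq ((√(frobSq Z))⁻¹ • Z) = 1 := by
  rw [frobSq_smul, inv_pow, Real.sq_sqrt (frobSq_nonneg Z),
    inv_mul_cancel₀ (frobSq_eq_zero.not.mpr h0)]

/-- The point of the visual sphere on the half-line through a non-zero matrix. -/
noncomputable def normalize (Z : Matrix (Fin m) (Fin m) ℝ) (hZ : Z ∈ symTraceless m) (h0 : Z ≠ 0) :
    VisualSphere m :=
  ⟨(√(frobSq Z))⁻¹ • Z, ((symTraceless m).smul_mem _ hZ).1, ((symTraceless m).smul_mem _ hZ).2,
    frobSq_normalize h0⟩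

theorem continuous_normalize {Y : Type*} [TopologicalSpace Y] {f : Y → Matrix (Fin m) (Fin m) ℝ}
    (hf : Continuous f) (hs : ∀ y, f y ∈ symTraceless m) (h0 : ∀ y, f y ≠ 0) :
    Continuous fun y => normalize (f y) (hs y) (h0 y) := by
  have h : Continuous fun y => √(frobSq (f y)) := (continuous_frobSq.comp hf).sqrt
  exact Continuous.subtype_mk (Continuous.smul (h.inv₀ fun y => (Real.sqrt_pos.mpr (lt_of_le_of_ne (frobSq_nonneg _)
      (Ne.symm (frobSq_eq_zero.not.mpr (h0 y))))).ne') hf) _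

theorem normalize_coe (Z : VisualSphere m) : normalize Z.1 Z.mem_symTraceless Z.ne_zero = Z := by
  apply Subtype.ext
  simp [normalize, Z.frobSq_eq]

/-- The unit sphere of the image of a linear projection is not contractible in the complement of
its kernel. -/
theorem not_contractsIn_of_projection (r : Matrix (Fin m) (Fin m) ℝ →ₗ[ℝ] Matrix (Fin m) (Fin m) ℝ)
    (hr : ∀ Z ∈ symTraceless m, r Z ∈ symTraceless m)
    (hrr : ∀ Z ∈ symTraceless m, r (r Z) = r Z) :
    ¬ ContractsIn {Z : VisualSphere m | r Z.1 = Z.1} {Z : VisualSphere m | r Z.1 = 0}ᶜ := by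
  intro hc
  obtain ⟨H, y, hH, hy, hC, h0, h1⟩ := hc.exists_homotopy
  have hrc : Continuous r := LinearMap.continuous_of_finiteDimensional r
  let V : Submodule ℝ (Matrix (Fin m) (Fin m) ℝ) := symTraceless m ⊓ LinearMap.ker (r - LinearMap.id)
  have hV : ∀ x : V, r x.1 = x.1 := fun x => by
    have h : r x.1 - x.1 = 0 := x.2.2
    exact sub_eq_zero.mp h
  let rV : VisualSphere m → V := fun Z => ⟨r Z.1, hr _ Z.mem_symTraceless, by
    exact LinearMap.mem_ker.mpr (sub_eq_zero.mpr (hrr _ Z.mem_symTraceless))⟩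
  have hrV : Continuous rV := Continuous.subtype_mk (hrc.comp continuous_subtype_val) _
  have hrV0 : ∀ Z ∈ {Z : VisualSphere m | r Z.1 = 0}ᶜ, rV Z ≠ 0 := fun Z hZ h =>
    hZ (congrArg Subtype.val h)
  have hne : ∀ x : {x : V // x ≠ 0}, x.1.1 ≠ 0 := fun x h => x.2 (Subtype.ext h)
  let nA : {x : V // x ≠ 0} → {Z : VisualSphere m | r Z.1 = Z.1} := fun x =>
    ⟨normalize x.1.1 x.1.2.1 (hne x), by
      change r ((√(frobSq x.1.1))⁻¹ • x.1.1) = (√(frobSq x.1.1))⁻¹ • x.1.1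
      rw [map_smul, hV]⟩
  have hnA : Continuous nA := Continuous.subtype_mk
    (continuous_normalize (continuous_subtype_val.comp continuous_subtype_val)
      (fun x : {x : V // x ≠ 0} => x.1.2.1) hne) _
  let N : V → ℝ := fun x => √(frobSq x.1)
  have hN : Continuous N := (continuous_frobSq.comp continuous_subtype_val).sqrt
  -- This time is `1` for `N x ≤ 1/2`, so that `F` is constant near the origin, and `0` for `N x ≥
  -- 1`, where the homotopy is still the inclusion.
  let τ : V → unitInterval := fun x => Set.projIcc 0 1 zero_le_one (2 - 2 * N x)
  have hτ : Continuous τ := continuous_projIcc.comp (by fun_prop)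
  classical
  -- The homotopy avoids the kernel of `r`, so `F` has no zero; the factor `max 1 (N x)` restores
  -- the length outside the unit ball, where `F` becomes the identity.
  let F : V → V := fun x =>
    if hx : x ≠ 0 then max 1 (N x) • rV (H (τ x, nA ⟨x, hx⟩)) else rV y
  have hmax : ∀ x, max 1 (N x) ≠ 0 := fun x => (zero_lt_one.trans_le (le_max_left _ _)).ne'
  refine NoRetraction.no_nonvanishing (F := F) (K := {x : V | frobSq x.1 ≤ 1}) ?_ ?_ ?_ ?_
  · rw [continuous_iff_continuousAt]
    intro x
    by_cases hx : x = 0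
    · subst hx
      have hev : ∀ᶠ z : V in nhds 0, N z < 1 / 2 :=
        hN.continuousAt.eventually_lt continuousAt_const (by simp [N, frobSq])
      have : F =ᶠ[nhds 0] fun _ => rV y := by
        filter_upwards [hev] with z hz
        by_cases hz0 : z = 0
        · simp [F, hz0]
        · have hτz : τ z = 1 := Set.projIcc_of_right_le _ (by linarith)
          have hm1 : max 1 (N z) = 1 := max_eq_left (by linarith)
          simp only [F, ne_eq, hz0, not_false_eq_true, dite_true, hτz, h1, hm1, one_smul]
      exact continuousAt_const.congr this.symm
    · have ho : IsOpen {x : V | x ≠ 0} := isOpen_ne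
      rw [← ho.isOpenEmbedding_subtypeVal.continuousAt_iff (x := ⟨x, hx⟩)]
      have hFe : F ∘ Subtype.val = fun x : {x : V // x ≠ 0} =>
          max 1 (N x.1) • rV (H (τ x.1, nA x)) := by
        funext z
        have := z.2
        simp [F, this]
      have hFc : Continuous fun x : {x : V // x ≠ 0} => max 1 (N x.1) • rV (H (τ x.1, nA x)) :=
        (continuous_const.max (hN.comp continuous_subtype_val)).smul
          (hrV.comp (hH.comp ((hτ.comp continuous_subtype_val).prodMk hnA)))
      exact (hFe ▸ hFc.continuousAt : ContinuousAt (F ∘ Subtype.val) _)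
  · intro x
    by_cases hx : x = 0
    · simpa [F, hx] using hrV0 y hy
    · simp only [F, ne_eq, hx, not_false_eq_true, dite_true]
      exact smul_ne_zero (hmax x) (hrV0 _ (hC _))
  · exact (Submodule.closed_of_finiteDimensional V).isClosedEmbedding_subtypeVal.isCompact_preimage
      (isCompact_frobSq_le 1)
  · intro x hx
    have hx1 : 1 < frobSq x.1 := not_le.mp hx
    have hN1 : 1 ≤ N x := Real.one_le_sqrt.mpr hx1.le
    have hx0 : x ≠ 0 := by
      rintro rfl
      exact absurd hx1 (by simp [frobSq])
    have hτx : τ x = 0 := Set.projIcc_of_le_left _ (by linarith)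
    simp only [F, ne_eq, hx0, not_false_eq_true, dite_true, hτx, h0, max_eq_right hN1]
    apply Subtype.ext
    change N x • r ((N x)⁻¹ • x.1) = x.1
    rw [map_smul, hV, smul_smul, mul_inv_cancel₀ (by linarith), one_smul]

end SLSymm

namespace SLSymm

open Matrix

variable {m : ℕ}

/-! ### Spectral preliminaries -/

theorem exp_smul_conj_diagonal {U : Matrix (Fin m) (Fin m) ℝ} (hU : U * Uᵀ = 1) (μ : Fin m → ℝ)
    (t : ℝ) : NormedSpace.exp (t • (U * diagonal μ * Uᵀ)) =
      U * diagonal (fun i => Real.exp (t * μ i)) * Uᵀ := by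
  have hinv : U⁻¹ = Uᵀ := inv_eq_right_inv hU
  have hu : IsUnit U := (isUnit_iff_isUnit_det U).mpr (isUnit_det_of_right_inverse hU)
  have h1 : t • (U * diagonal μ * Uᵀ) = U * diagonal (t • μ) * U⁻¹ := by
    rw [hinv, diagonal_smul, Matrix.mul_smul, Matrix.smul_mul]
  rw [h1, exp_conj U _ hu, exp_diagonal, hinv]
  congr 3
  funext i
  rw [Pi.coe_exp, Real.exp_eq_exp_ℝ]
  rfl

/-- Orthogonal diagonalisation with decreasing eigenvalues. -/
theorem exists_antitone_diagonalization {Z : Matrix (Fin m) (Fin m) ℝ} (hZ : Z.IsSymm) :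
    ∃ (U : Matrix (Fin m) (Fin m) ℝ) (μ : Fin m → ℝ), U * Uᵀ = 1 ∧ Antitone μ ∧
      Z = U * diagonal μ * Uᵀ := by
  have hH : Z.IsHermitian := by
    rw [IsHermitian, conjTranspose_eq_transpose_of_trivial]; exact hZ
  have hsp := hH.spectral_theorem
  rw [Unitary.conjStarAlgAut_apply] at hsp
  set V : Matrix (Fin m) (Fin m) ℝ := (hH.eigenvectorUnitary : Matrix (Fin m) (Fin m) ℝ)
  have hVV : V * Vᵀ = 1 := by
    have : V * star V = 1 := Unitary.coe_mul_star_self hH.eigenvectorUnitary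
    rwa [star_eq_conjTranspose, conjTranspose_eq_transpose_of_trivial] at this
  have hsp' : Z = V * diagonal hH.eigenvalues * Vᵀ := by
    rw [star_eq_conjTranspose, conjTranspose_eq_transpose_of_trivial] at hsp
    exact hsp
  let σ := Tuple.sort fun i => -hH.eigenvalues i
  have hσ : Antitone (hH.eigenvalues ∘ σ) := fun i j hij =>
    neg_le_neg_iff.mp (Tuple.monotone_sort (fun i => -hH.eigenvalues i) hij)
  refine ⟨V.submatrix id σ, hH.eigenvalues ∘ σ, ?_, hσ, ?_⟩
  · rw [transpose_submatrix, submatrix_mul_equiv, hVV, submatrix_id_id]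
  · rw [← submatrix_diagonal_equiv hH.eigenvalues σ, transpose_submatrix, submatrix_mul_equiv,
      submatrix_mul_equiv, submatrix_id_id]
    exact hsp'

theorem exists_diagonalization {Z : Matrix (Fin m) (Fin m) ℝ} (hZ : Z.IsSymm) :
    ∃ (U : Matrix (Fin m) (Fin m) ℝ) (μ : Fin m → ℝ), U * Uᵀ = 1 ∧ Uᵀ * U = 1 ∧
      Z = U * diagonal μ * Uᵀ := by
  obtain ⟨U, μ, hU, -, h⟩ := exists_antitone_diagonalization hZ
  exact ⟨U, μ, hU, mul_eq_one_comm.mp hU, h⟩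

theorem dotProduct_conj_diagonal (U : Matrix (Fin m) (Fin m) ℝ) (μ v : Fin m → ℝ) :
    v ⬝ᵥ (U * diagonal μ * Uᵀ) *ᵥ v = ∑ i, μ i * (Uᵀ *ᵥ v) i ^ 2 := by
  rw [← mulVec_mulVec, ← mulVec_mulVec, dotProduct_mulVec, ← mulVec_transpose]
  simp only [dotProduct, mulVec_diagonal]
  exact Finset.sum_congr rfl fun i _ => by ring

theorem dotProduct_transpose_mulVec {U : Matrix (Fin m) (Fin m) ℝ} (hU : U * Uᵀ = 1)
    (v : Fin m → ℝ) : v ⬝ᵥ v = ∑ i, (Uᵀ *ᵥ v) i ^ 2 := by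
  have := dotProduct_conj_diagonal U 1 v
  rw [show diagonal (1 : Fin m → ℝ) = 1 from diagonal_one, mul_one, hU, one_mulVec] at this
  simpa using this

/-- The exponential growth rate of `exp (t ξ) v` bounds the Rayleigh quotient of `ξ` at `v`, with
equality only for eigenvectors. -/
theorem rayleigh_le_of_exp_growth {ξ : Matrix (Fin m) (Fin m) ℝ} (hξ : ξ.IsSymm) {v : Fin m → ℝ}
    {l C : ℝ} (h : ∀ t : ℝ, 0 ≤ t → (NormedSpace.exp (t • ξ) *ᵥ v) ⬝ᵥ (NormedSpace.exp (t • ξ) *ᵥ v)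
      ≤ C * Real.exp (t * l) ^ 2) :
    v ⬝ᵥ ξ *ᵥ v ≤ l * (v ⬝ᵥ v) ∧ (v ⬝ᵥ ξ *ᵥ v = l * (v ⬝ᵥ v) → ξ *ᵥ v = l • v) := by
  obtain ⟨U, μ, hU, hU', rfl⟩ := exists_diagonalization hξ
  set c := Uᵀ *ᵥ v with hc
  have hexp : ∀ t : ℝ, 0 ≤ t → ∑ i, (Real.exp (t * μ i) * c i) ^ 2 ≤ C * Real.exp (t * l) ^ 2 := by
    intro t ht
    refine le_trans (le_of_eq ?_) (h t ht)
    rw [dotProduct_transpose_mulVec hU, exp_smul_conj_diagonal hU, mul_assoc, ← mulVec_mulVec,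
      mulVec_mulVec, hU', one_mulVec, ← mulVec_mulVec, ← hc]
    simp only [mulVec_diagonal]
  -- An eigenvalue above `l` would make its component outgrow the bound, so that component of `v`
  -- vanishes.
  have hterm : ∀ i, 0 ≤ (l - μ i) * c i ^ 2 := by
    intro i
    by_cases hi : μ i ≤ l
    · exact mul_nonneg (sub_nonneg.mpr hi) (sq_nonneg _)
    · have hδ : 0 < μ i - l := by linarith [not_le.mp hi]
      suffices c i = 0 by simp [this]
      by_contra hci
      have hpos : 0 < c i ^ 2 := by positivity
      have hbound : ∀ t : ℝ, 0 ≤ t → c i ^ 2 * (1 + 2 * t * (μ i - l)) ≤ C := by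
        intro t ht
        have h1 := (Finset.single_le_sum (f := fun i => (Real.exp (t * μ i) * c i) ^ 2)
          (fun _ _ => sq_nonneg _) (Finset.mem_univ i)).trans (hexp t ht)
        have h2 : Real.exp (t * μ i) = Real.exp (t * l) * Real.exp (t * (μ i - l)) := by
          rw [← Real.exp_add]; ring_nf
        have h3 : 1 + 2 * t * (μ i - l) ≤ Real.exp (t * (μ i - l)) ^ 2 := by
          rw [sq, ← Real.exp_add]
          have := Real.add_one_le_exp (t * (μ i - l) + t * (μ i - l))
          linarith
        have h4 : 0 < Real.exp (t * l) ^ 2 := by positivity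
        rw [h2, mul_pow, mul_pow, mul_assoc, mul_comm C, mul_le_mul_iff_right₀ h4] at h1
        calc _ ≤ c i ^ 2 * Real.exp (t * (μ i - l)) ^ 2 := by gcongr
          _ ≤ C := by rwa [mul_comm]
      have hC : 0 ≤ C := by have := hbound 0 le_rfl; simp at this; linarith
      -- At this time the left side of `hbound` equals `c i ^ 2 + C`.
      have h5 := hbound (C / (2 * (μ i - l) * c i ^ 2)) (by positivity)
      have h6 : c i ^ 2 * (1 + 2 * (C / (2 * (μ i - l) * c i ^ 2)) * (μ i - l)) = c i ^ 2 + C := by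
        field_simp
      linarith
  have hsum : ∑ i, (l - μ i) * c i ^ 2 = l * (v ⬝ᵥ v) - v ⬝ᵥ (U * diagonal μ * Uᵀ) *ᵥ v := by
    rw [dotProduct_conj_diagonal, dotProduct_transpose_mulVec hU, Finset.mul_sum,
      ← Finset.sum_sub_distrib]
    exact Finset.sum_congr rfl fun i _ => by ring
  refine ⟨by linarith [hsum ▸ Finset.sum_nonneg fun i _ => hterm i], fun heq => ?_⟩
  -- In the equality case every term vanishes: only components with eigenvalue `l` survive.
  rw [heq, sub_self, Finset.sum_eq_zero_iff_of_nonneg fun i _ => hterm i] at hsum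
  have hd : diagonal μ *ᵥ c = l • c := by
    funext i
    rw [mulVec_diagonal, Pi.smul_apply, smul_eq_mul]
    rcases mul_eq_zero.mp (hsum i (Finset.mem_univ i)) with h | h
    · rw [sub_eq_zero.mp h]
    · rw [(pow_eq_zero_iff two_ne_zero).mp h, mul_zero, mul_zero]
  rw [mul_assoc, ← mulVec_mulVec, ← mulVec_mulVec, ← hc, hd, mulVec_smul, hc, mulVec_mulVec, hU,
    one_mulVec]

theorem exp_smul_mulVec_of_eigenvector {Z : Matrix (Fin m) (Fin m) ℝ} (hZ : Z.IsSymm)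
    {x : Fin m → ℝ} {l : ℝ} (hx : Z *ᵥ x = l • x) (t : ℝ) :
    NormedSpace.exp (t • Z) *ᵥ x = Real.exp (t * l) • x := by
  obtain ⟨U, μ, hU, hU', rfl⟩ := exists_diagonalization hZ
  set c := Uᵀ *ᵥ x with hc
  have hd : diagonal μ *ᵥ c = l • c := by
    have := congrArg (Uᵀ *ᵥ ·) hx
    simp only [mulVec_smul] at this
    rwa [mulVec_mulVec, mul_assoc, ← mul_assoc, hU', one_mul, ← mulVec_mulVec, ← hc] at this
  have hd' : diagonal (fun i => Real.exp (t * μ i)) *ᵥ c = Real.exp (t * l) • c := by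
    funext i
    have := congrFun hd i
    rw [mulVec_diagonal, Pi.smul_apply, smul_eq_mul] at this ⊢
    rcases mul_eq_mul_right_iff.mp this with h | h
    · rw [h]
    · rw [h, mul_zero, mul_zero]
  rw [exp_smul_conj_diagonal hU, mul_assoc, ← mulVec_mulVec, ← mulVec_mulVec, ← hc, hd',
    mulVec_smul, hc, mulVec_mulVec, hU, one_mulVec]

/-- Every matrix is an orthogonal matrix times an upper triangular one. -/
theorem exists_orthogonal_upper_triangular (M : Matrix (Fin m) (Fin m) ℝ) :
    ∃ k : Matrix (Fin m) (Fin m) ℝ, k * kᵀ = 1 ∧ ∀ i j, j < i → (kᵀ * M) i j = 0 := by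
  let f : Fin m → EuclideanSpace ℝ (Fin m) := fun j => WithLp.toLp 2 fun i => M i j
  let b := InnerProductSpace.gramSchmidtOrthonormalBasis (𝕜 := ℝ) (by simp) f
  refine ⟨of fun i j => b j i, mul_eq_one_comm.mp ?_, fun i j hij => ?_⟩
  · ext i j
    have := orthonormal_iff_ite.mp b.orthonormal i j
    rw [one_apply, ← this]
    simp [mul_apply, PiLp.inner_apply, mul_comm]
  · have := InnerProductSpace.gramSchmidtOrthonormalBasis_inv_triangular (𝕜 := ℝ) (by simp) f hij
    rw [← this]
    simp [mul_apply, PiLp.inner_apply, f, b, mul_comm]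

/-! ### The distance in terms of the Frobenius norm -/

theorem frobSq_eq_trace (M : Matrix (Fin m) (Fin m) ℝ) : frobSq M = (M * Mᵀ).trace := by
  simp [frobSq, trace, mul_apply, sq]

theorem frobSq_transpose (M : Matrix (Fin m) (Fin m) ℝ) : frobSq Mᵀ = frobSq M :=
  Finset.sum_comm

theorem frobSq_mul_orthogonal (M : Matrix (Fin m) (Fin m) ℝ) {U : Matrix (Fin m) (Fin m) ℝ}
    (hU : U * Uᵀ = 1) : frobSq (M * U) = frobSq M := by
  rw [frobSq_eq_trace, frobSq_eq_trace, transpose_mul, mul_assoc, ← mul_assoc U, hU, one_mul]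

theorem frobSq_orthogonal_mul (M : Matrix (Fin m) (Fin m) ℝ) {U : Matrix (Fin m) (Fin m) ℝ}
    (hU : Uᵀ * U = 1) : frobSq (U * M) = frobSq M := by
  rw [← frobSq_transpose, transpose_mul, frobSq_mul_orthogonal _ (by rwa [transpose_transpose]),
    frobSq_transpose]

theorem gram_mk (a : SpecialLinearGroup (Fin m) ℝ) :
    gram (QuotientGroup.mk a : SymSpace m) = a.1 * a.1ᵀ := rfl

theorem coe_inv_mul_coe (a : SpecialLinearGroup (Fin m) ℝ) : (a⁻¹).1 * a.1 = 1 :=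
  congrArg Subtype.val (inv_mul_cancel a)

theorem coe_mul_coe_inv (a : SpecialLinearGroup (Fin m) ℝ) : a.1 * (a⁻¹).1 = 1 :=
  congrArg Subtype.val (mul_inv_cancel a)

/-- The positive eigenvalues that compute the distance. -/
theorem exists_sdist_eq (a b : SpecialLinearGroup (Fin m) ℝ) :
    ∃ l : Fin m → ℝ, (∀ i, 0 < l i) ∧ ∏ i, l i = 1 ∧ ∑ i, l i = frobSq (a⁻¹ * b).1 ∧
      sdist (QuotientGroup.mk a : SymSpace m) (QuotientGroup.mk b) =
        √(∑ i, (Real.log (l i) / 2) ^ 2) := by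
  set n := a⁻¹ * b with hn
  have hp : (n.1 * n.1ᵀ).PosDef := by
    have := PosDef.mul_conjTranspose_self n.1 (vecMul_injective_of_isUnit
      ((isUnit_iff_isUnit_det _).mpr (by rw [n.2]; exact isUnit_one)))
    rwa [conjTranspose_eq_transpose_of_trivial] at this
  have hH := hp.isHermitian
  refine ⟨hH.eigenvalues, hp.eigenvalues_pos, ?_, ?_, ?_⟩
  · have := hH.det_eq_prod_eigenvalues
    rw [det_mul, det_transpose, n.2, mul_one] at this
    simpa using this.symm
  · have := hH.trace_eq_sum_eigenvalues
    rw [← frobSq_eq_trace] at this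
    simpa using this.symm
  · have hinv : (a.1 * a.1ᵀ)⁻¹ = (a⁻¹).1ᵀ * (a⁻¹).1 := by
      apply inv_eq_left_inv
      rw [mul_assoc, ← mul_assoc _ a.1, coe_inv_mul_coe, one_mul, ← transpose_mul, coe_mul_coe_inv,
        transpose_one]
    have hcp : ((a.1 * a.1ᵀ)⁻¹ * (b.1 * b.1ᵀ)).charpoly = (n.1 * n.1ᵀ).charpoly := by
      rw [hinv, mul_assoc, charpoly_mul_comm, show n.1 = (a⁻¹).1 * b.1 from rfl, transpose_mul]
      simp only [mul_assoc]
    rw [sdist, gram_mk, gram_mk, hcp, hH.roots_charpoly_eq_eigenvalues, Multiset.map_map]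
    rfl

theorem frobSq_le_of_sdist_le {a b : SpecialLinearGroup (Fin m) ℝ} {C : ℝ}
    (h : sdist (QuotientGroup.mk a : SymSpace m) (QuotientGroup.mk b) ≤ C) :
    frobSq (a⁻¹ * b).1 ≤ m * Real.exp (2 * C) := by
  obtain ⟨l, hl, -, hsum, hd⟩ := exists_sdist_eq a b
  rw [hd, Real.sqrt_le_iff] at h
  have hle : ∀ i, l i ≤ Real.exp (2 * C) := by
    intro i
    have h1 := (Finset.single_le_sum (f := fun i => (Real.log (l i) / 2) ^ 2)
      (fun _ _ => sq_nonneg _) (Finset.mem_univ i)).trans h.2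
    have h2 := (abs_le.mp (abs_le_of_sq_le_sq h1 h.1)).2
    rw [← Real.log_le_iff_le_exp (hl i)]
    linarith
  rw [← hsum]
  calc ∑ i, l i ≤ ∑ _i : Fin m, Real.exp (2 * C) := Finset.sum_le_sum fun i _ => hle i
    _ = _ := by simp

/-- The trace bounds every eigenvalue from above. As the determinant is `1`, the logarithms sum to
zero, so upper bounds on the others give a lower bound on each. -/
theorem exists_sdist_le_of_frobSq_le (m : ℕ) (c : ℝ) : ∃ C : ℝ,
    ∀ a b : SpecialLinearGroup (Fin m) ℝ, frobSq (a⁻¹ * b).1 ≤ c →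
      sdist (QuotientGroup.mk a : SymSpace m) (QuotientGroup.mk b) ≤ C := by
  set ℓ := Real.log (max 1 c) with hℓ
  have hℓ0 : 0 ≤ ℓ := Real.log_nonneg (le_max_left _ _)
  refine ⟨√(∑ _i : Fin m, (((m : ℝ) + 1) * ℓ / 2) ^ 2), fun a b h => ?_⟩
  obtain ⟨l, hl, hprod, hsum, hd⟩ := exists_sdist_eq a b
  rw [hd]
  refine Real.sqrt_le_sqrt (Finset.sum_le_sum fun i _ => ?_)
  have hup : ∀ j, Real.log (l j) ≤ ℓ := fun j =>
    Real.log_le_log (hl j) (((Finset.single_le_sum (fun k _ => (hl k).le)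
      (Finset.mem_univ j)).trans (hsum.le.trans h)).trans (le_max_right _ _))
  have hlog : ∑ j, Real.log (l j) = 0 := by
    rw [← Real.log_prod fun j _ => (hl j).ne', hprod, Real.log_one]
  have hlow : -(m * ℓ) ≤ Real.log (l i) := by
    rw [← Finset.add_sum_erase _ _ (Finset.mem_univ i)] at hlog
    have h1 : ∑ j ∈ Finset.univ.erase i, Real.log (l j) ≤ ∑ _j ∈ Finset.univ.erase i, ℓ :=
      Finset.sum_le_sum fun j _ => hup j
    have h2 : ∑ _j ∈ Finset.univ.erase i, ℓ ≤ m * ℓ := by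
      rw [Finset.sum_const, nsmul_eq_mul]
      gcongr
      exact (Finset.card_le_univ _).trans (by simp)
    linarith
  refine sq_le_sq' ?_ ?_
  · nlinarith
  · have := hup i
    have : 0 ≤ (m : ℝ) * ℓ := by positivity
    nlinarith

end SLSymm

namespace SLSymm

open Matrix

variable {m : ℕ}

/-! ### Asymptotic rays -/

theorem expSL_coe (Z : VisualSphere m) (t : ℝ) : (expSL Z t).1 = NormedSpace.exp (t • Z.1) := rfl

theorem expSL_inv (Z : VisualSphere m) (t : ℝ) : (expSL Z t)⁻¹ = expSL Z (-t) := by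
  rw [inv_eq_iff_mul_eq_one]
  apply Subtype.ext
  change NormedSpace.exp (t • Z.1) * NormedSpace.exp (-t • Z.1) = 1
  rw [← Matrix.exp_add_of_commute _ _ (((Commute.refl Z.1).smul_left t).smul_right (-t)), ← add_smul,
    add_neg_cancel, zero_smul, NormedSpace.exp_zero]

theorem expSL_transpose (Z : VisualSphere m) (t : ℝ) : (expSL Z t).1ᵀ = (expSL Z t).1 :=
  IsSymm.exp (Z.2.1.smul t)

theorem continuous_expSL (t : ℝ) : Continuous fun Z : VisualSphere m => expSL Z t := by
  refine Continuous.subtype_mk ?_ _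
  have : Continuous (NormedSpace.exp : Matrix (Fin m) (Fin m) ℝ → _) := by
    open scoped Matrix.Norms.Operator in
    exact NormedSpace.exp_continuous
  exact this.comp (continuous_subtype_val.const_smul t)

theorem isCompact_sl_frobSq_le (c : ℝ) :
    IsCompact {n : SpecialLinearGroup (Fin m) ℝ | frobSq n.1 ≤ c} :=
  SpecialLinearGroup.isClosedEmbedding_val.isCompact_preimage (isCompact_frobSq_le c)

theorem exists_frobSq_le {K : Set (SpecialLinearGroup (Fin m) ℝ)} (hK : IsCompact K) :
    ∃ c, ∀ n ∈ K, frobSq n.1 ≤ c := by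
  obtain ⟨c, hc⟩ := (hK.image (continuous_frobSq.comp continuous_subtype_val)).bddAbove
  exact ⟨c, fun n hn => hc ⟨n, hn, rfl⟩⟩

/-- The ray `t ↦ g exp (t Z) o` is asymptotic to `t ↦ exp (t ξ) o`, in terms of the relative
position. -/
def RayAsymptotic (g : SpecialLinearGroup (Fin m) ℝ) (Z ξ : VisualSphere m) : Prop :=
  ∃ K : Set (SpecialLinearGroup (Fin m) ℝ), IsCompact K ∧
    ∀ t : ℝ, 0 ≤ t → (expSL ξ t)⁻¹ * g * expSL Z t ∈ K

theorem RayAsymptotic.inv {g : SpecialLinearGroup (Fin m) ℝ} {Z ξ : VisualSphere m}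
    (h : RayAsymptotic g Z ξ) : RayAsymptotic g⁻¹ ξ Z := by
  obtain ⟨K, hK, h⟩ := h
  refine ⟨K⁻¹, hK.inv, fun t ht => ?_⟩
  have := h t ht
  rw [Set.mem_inv]
  convert this using 1
  group

theorem RayAsymptotic.trans {g h : SpecialLinearGroup (Fin m) ℝ} {Z ξ ζ : VisualSphere m}
    (hg : RayAsymptotic g Z ξ) (hh : RayAsymptotic h ξ ζ) : RayAsymptotic (h * g) Z ζ := by
  obtain ⟨K, hK, hg⟩ := hg
  obtain ⟨K', hK', hh⟩ := hh
  open scoped Pointwise in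
  refine ⟨K' * K, hK'.mul hK, fun t ht => ?_⟩
  convert Set.mul_mem_mul (hh t ht) (hg t ht) using 1
  group

theorem rayAsymptotic_of_frobSq_le {g : SpecialLinearGroup (Fin m) ℝ} {Z ξ : VisualSphere m} {c : ℝ}
    (h : ∀ t : ℝ, 0 ≤ t → frobSq ((expSL ξ t)⁻¹ * g * expSL Z t).1 ≤ c) : RayAsymptotic g Z ξ :=
  ⟨_, isCompact_sl_frobSq_le c, h⟩

/-- Bounded distance amounts to a bounded Frobenius norm of the relative position, and Frobenius
balls in `SL_m(ℝ)` are compact. The distance controls the inverse of the matrix used in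
`RayAsymptotic`, hence the passage through `RayAsymptotic.inv`. -/
theorem asymptotic_geodesic_iff {g : SpecialLinearGroup (Fin m) ℝ} {Z ξ : VisualSphere m} :
    Asymptotic (geodesic g Z) (geodesic 1 ξ) ↔ RayAsymptotic g Z ξ := by
  constructor
  · rintro ⟨C, hC⟩
    have : RayAsymptotic g⁻¹ ξ Z := by
      refine rayAsymptotic_of_frobSq_le (c := m * Real.exp (2 * C)) fun t ht => ?_
      have h := frobSq_le_of_sdist_le (hC t ht)
      convert h using 3
      group
    simpa using this.inv
  · intro h
    obtain ⟨K, hK, h⟩ := h.inv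
    obtain ⟨c, hc⟩ := exists_frobSq_le hK
    obtain ⟨C, hC⟩ := exists_sdist_le_of_frobSq_le m c
    refine ⟨C, fun t ht => hC _ _ ?_⟩
    convert hc _ (h t ht) using 3
    group

theorem dotProduct_self_mulVec_le (M : Matrix (Fin m) (Fin m) ℝ) (v : Fin m → ℝ) :
    (M *ᵥ v) ⬝ᵥ (M *ᵥ v) ≤ frobSq M * (v ⬝ᵥ v) := by
  simp only [dotProduct, mulVec, frobSq, Finset.sum_mul, ← sq]
  exact Finset.sum_le_sum fun i _ => by
    simpa [Finset.sum_mul] using Finset.sum_mul_sq_le_sq_mul_sq Finset.univ (M i) v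

theorem dotProduct_self_smul (c : ℝ) (v : Fin m → ℝ) : (c • v) ⬝ᵥ (c • v) = c ^ 2 * (v ⬝ᵥ v) := by
  rw [smul_dotProduct, dotProduct_smul, smul_eq_mul, smul_eq_mul]; ring

theorem expSL_mulVec_of_eigenvector (Z : VisualSphere m) {x : Fin m → ℝ} {l : ℝ}
    (hx : Z.1 *ᵥ x = l • x) (t : ℝ) : (expSL Z t).1 *ᵥ x = Real.exp (t * l) • x :=
  exp_smul_mulVec_of_eigenvector Z.2.1 hx t

/-- Eigenvectors of the direction of a ray bound the Rayleigh quotients of its point at infinity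
from above, in the dual space. -/
theorem RayAsymptotic.rayleigh_le {g : SpecialLinearGroup (Fin m) ℝ} {Z ξ : VisualSphere m}
    (h : RayAsymptotic g Z ξ) {l : ℝ} {φ : Fin m → ℝ} (hφ : Z.1 *ᵥ (g.1ᵀ *ᵥ φ) = l • (g.1ᵀ *ᵥ φ)) :
    φ ⬝ᵥ ξ.1 *ᵥ φ ≤ l * (φ ⬝ᵥ φ) ∧ (φ ⬝ᵥ ξ.1 *ᵥ φ = l * (φ ⬝ᵥ φ) → ξ.1 *ᵥ φ = l • φ) := by
  obtain ⟨K, hK, h⟩ := h.inv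
  obtain ⟨c, hc⟩ := exists_frobSq_le hK
  refine rayleigh_le_of_exp_growth ξ.2.1
    (C := c * ((g.1ᵀ *ᵥ φ) ⬝ᵥ (g.1ᵀ *ᵥ φ))) fun t ht => ?_
  set y := g.1ᵀ *ᵥ φ with hy
  set n := (expSL Z t)⁻¹ * g⁻¹ * expSL ξ t with hn
  have hgn : g * expSL Z t * n = expSL ξ t := by rw [hn]; group
  have h1 : n.1ᵀ *ᵥ ((expSL Z t).1 *ᵥ y) = NormedSpace.exp (t • ξ.1) *ᵥ φ := by
    rw [← expSL_coe, ← expSL_transpose ξ, ← hgn, hy, mulVec_mulVec, mulVec_mulVec]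
    congr 1
    change _ = (g.1 * (expSL Z t).1 * n.1)ᵀ
    rw [transpose_mul, transpose_mul, expSL_transpose, mul_assoc]
  rw [← h1, expSL_mulVec_of_eigenvector Z hφ, mulVec_smul, dotProduct_self_smul, mul_comm]
  have h2 := dotProduct_self_mulVec_le n.1ᵀ y
  rw [frobSq_transpose] at h2
  have h3 : 0 ≤ y ⬝ᵥ y := Finset.sum_nonneg fun i _ => mul_self_nonneg _
  have := h2.trans (mul_le_mul_of_nonneg_right (hc _ (h t ht)) h3)
  gcongr

/-- Eigenvectors of the direction of a ray bound the Rayleigh quotients of its point at infinity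
from below. -/
theorem RayAsymptotic.le_rayleigh {g : SpecialLinearGroup (Fin m) ℝ} {Z ξ : VisualSphere m}
    (h : RayAsymptotic g Z ξ) {l : ℝ} {x : Fin m → ℝ} (hx : Z.1 *ᵥ x = l • x) :
    l * ((g.1 *ᵥ x) ⬝ᵥ (g.1 *ᵥ x)) ≤ (g.1 *ᵥ x) ⬝ᵥ ξ.1 *ᵥ (g.1 *ᵥ x) ∧
      ((g.1 *ᵥ x) ⬝ᵥ ξ.1 *ᵥ (g.1 *ᵥ x) = l * ((g.1 *ᵥ x) ⬝ᵥ (g.1 *ᵥ x)) →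
        ξ.1 *ᵥ (g.1 *ᵥ x) = l • (g.1 *ᵥ x)) := by
  obtain ⟨K, hK, h⟩ := h
  obtain ⟨c, hc⟩ := exists_frobSq_le hK
  have hgrow := rayleigh_le_of_exp_growth (ξ := -ξ.1) (v := g.1 *ᵥ x) (l := -l)
    (C := c * (x ⬝ᵥ x)) ξ.2.1.neg fun t ht => by
      set n := (expSL ξ t)⁻¹ * g * expSL Z t with hn
      have h1 : NormedSpace.exp (t • -ξ.1) *ᵥ (g.1 *ᵥ x) = Real.exp (t * -l) • (n.1 *ᵥ x) := by
        have hgn : n * (expSL Z t)⁻¹ = (expSL ξ t)⁻¹ * g := by rw [hn]; group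
        rw [expSL_inv, expSL_inv] at hgn
        have hgn' : n.1 * (expSL Z (-t)).1 = (expSL ξ (-t)).1 * g.1 := congrArg Subtype.val hgn
        rw [smul_neg, ← neg_smul, ← expSL_coe, mulVec_mulVec, ← hgn', ← mulVec_mulVec,
          expSL_mulVec_of_eigenvector Z hx, mulVec_smul, neg_mul, mul_neg]
      rw [h1, dotProduct_self_smul, mul_comm]
      have h3 : 0 ≤ x ⬝ᵥ x := Finset.sum_nonneg fun i _ => mul_self_nonneg _
      have := (dotProduct_self_mulVec_le n.1 x).trans
        (mul_le_mul_of_nonneg_right (hc _ (h t ht)) h3)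
      gcongr
  simp only [neg_mulVec, dotProduct_neg, neg_mul, neg_le_neg_iff, neg_inj, neg_smul] at hgrow
  exact hgrow

/-- For `g = 1` both Rayleigh bounds apply to each eigenvector of `Z`. Equality holds, so `ξ` has
the same eigenvectors and eigenvalues. -/
theorem RayAsymptotic.eq {Z ξ : VisualSphere m} (h : RayAsymptotic 1 Z ξ) : ξ = Z := by
  apply Subtype.ext
  have key : ∀ (l : ℝ) (x : Fin m → ℝ), Z.1 *ᵥ x = l • x → ξ.1 *ᵥ x = l • x := by
    intro l x hx
    have h1 := h.le_rayleigh hx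
    have hone : (1 : SpecialLinearGroup (Fin m) ℝ).1 = 1 := rfl
    have h2 := h.rayleigh_le (φ := x) (l := l) (by rwa [hone, transpose_one, one_mulVec])
    simp only [hone, one_mulVec] at h1
    exact h1.2 (le_antisymm h2.1 h1.1)
  obtain ⟨U, μ, hU, hU', hZ⟩ := exists_diagonalization Z.2.1
  have hcol : ξ.1 * U = U * diagonal μ := by
    ext i j
    have hZU : Z.1 * U = U * diagonal μ := by rw [hZ, mul_assoc, hU', mul_one]
    have h1 := key (μ j) (U.col j) (by
      funext i
      have := congrFun (congrFun hZU i) j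
      rw [mul_diagonal] at this
      simpa [mulVec, dotProduct, mul_apply, mul_comm] using this)
    have := congrFun h1 i
    rw [mul_diagonal]
    simpa [mulVec, dotProduct, mul_apply, mul_comm] using this
  rw [hZ, ← hcol, mul_assoc, hU, mul_one]

/-! ### The action on the visual sphere -/

/-- Diagonalise `Z` by `U` with decreasing `μ` and write `g U = k T` with `T` upper triangular; then
`ξ = k diag(μ) kᵀ`. Up to orthogonal factors the relative position has entries `T i j * exp (t * (μ
j - μ i))`, bounded by those of `T` because only `i ≤ j` matters. The bound is uniform in `Z` and
`t`, which later gives continuity. -/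
theorem exists_translate (g : SpecialLinearGroup (Fin m) ℝ) (Z : VisualSphere m) :
    ∃ ξ : VisualSphere m, ∀ t : ℝ, 0 ≤ t →
      frobSq ((expSL ξ t)⁻¹ * g * expSL Z t).1 ≤ frobSq g.1 := by
  obtain ⟨U, μ, hU, hμ, hZ⟩ := exists_antitone_diagonalization Z.2.1
  have hU' : Uᵀ * U = 1 := mul_eq_one_comm.mp hU
  obtain ⟨k, hk, hT⟩ := exists_orthogonal_upper_triangular (g.1 * U)
  have hk' : kᵀ * k = 1 := mul_eq_one_comm.mp hk
  have hkt : kᵀ * kᵀᵀ = 1 := by rwa [transpose_transpose]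
  have hUt : Uᵀ * Uᵀᵀ = 1 := by rwa [transpose_transpose]
  refine ⟨⟨k * diagonal μ * kᵀ, ?_, ?_, ?_⟩, fun t ht => ?_⟩
  · rw [IsSymm, transpose_mul, transpose_mul, transpose_transpose, diagonal_transpose, mul_assoc]
  · rw [trace_mul_comm, ← mul_assoc, hk', one_mul]
    have := Z.2.2.1
    rwa [hZ, trace_mul_comm, ← mul_assoc, hU', one_mul] at this
  · have := Z.frobSq_eq
    rw [hZ, frobSq_mul_orthogonal _ hUt, frobSq_orthogonal_mul _ hU'] at this
    change frobSq _ = 1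
    rw [frobSq_mul_orthogonal _ hkt, frobSq_orthogonal_mul _ hk', this]
  · rw [expSL_inv]
    change frobSq (NormedSpace.exp (-t • (k * diagonal μ * kᵀ)) * g.1 *
      NormedSpace.exp (t • Z.1)) ≤ _
    set T := kᵀ * (g.1 * U) with hTdef
    have h1 : NormedSpace.exp (-t • (k * diagonal μ * kᵀ)) * g.1 * NormedSpace.exp (t • Z.1) =
        k * (diagonal (fun i => Real.exp (-t * μ i)) * T *
          diagonal fun i => Real.exp (t * μ i)) * Uᵀ := by
      rw [hZ, exp_smul_conj_diagonal hk, exp_smul_conj_diagonal hU, hTdef]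
      simp only [mul_assoc]
    have h2 : frobSq g.1 = frobSq T := by
      rw [hTdef, frobSq_orthogonal_mul _ (by rwa [transpose_transpose]), frobSq_mul_orthogonal _ hU]
    rw [h1, frobSq_mul_orthogonal _ hUt, frobSq_orthogonal_mul _ hk', h2]
    refine Finset.sum_le_sum fun i _ => Finset.sum_le_sum fun j _ => ?_
    rw [mul_diagonal, diagonal_mul]
    rcases lt_or_ge j i with hij | hij
    · simp [hT i j hij]
    · have h3 : Real.exp (-t * μ i) * T i j * Real.exp (t * μ j) =
          T i j * Real.exp (t * (μ j - μ i)) := by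
        rw [mul_sub, sub_eq_add_neg, Real.exp_add]; ring_nf
      have h4 : Real.exp (t * (μ j - μ i)) ≤ 1 := by
        rw [Real.exp_le_one_iff]
        have := hμ hij
        nlinarith
      rw [h3, mul_pow]
      exact mul_le_of_le_one_right (sq_nonneg _) (pow_le_one₀ (Real.exp_nonneg _) h4)

/-- The action of `SL_m(ℝ)` on the visual sphere. -/
noncomputable def translate (g : SpecialLinearGroup (Fin m) ℝ) (Z : VisualSphere m) :
    VisualSphere m := (exists_translate g Z).choose

theorem rayAsymptotic_translate (g : SpecialLinearGroup (Fin m) ℝ) (Z : VisualSphere m) :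
    RayAsymptotic g Z (translate g Z) :=
  rayAsymptotic_of_frobSq_le (exists_translate g Z).choose_spec

theorem RayAsymptotic.translate_eq {g : SpecialLinearGroup (Fin m) ℝ} {Z ξ : VisualSphere m}
    (h : RayAsymptotic g Z ξ) : translate g Z = ξ := by
  have := h.inv.trans (rayAsymptotic_translate g Z)
  rw [mul_inv_cancel] at this
  exact this.eq

instance : CompactSpace (VisualSphere m) := by
  refine isCompact_iff_compactSpace.mp ?_
  refine (isCompact_frobSq_le (m := m) 1).of_isClosed_subset ?_ fun Z hZ => hZ.2.2.le
  have h1 : IsClosed {Z : Matrix (Fin m) (Fin m) ℝ | Z.IsSymm} :=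
    isClosed_eq (continuous_id.matrix_transpose) continuous_id
  have h2 : IsClosed {Z : Matrix (Fin m) (Fin m) ℝ | Z.trace = 0} :=
    isClosed_eq (continuous_id.matrix_trace) continuous_const
  have h3 : IsClosed {Z : Matrix (Fin m) (Fin m) ℝ | frobSq Z = 1} :=
    isClosed_eq continuous_frobSq continuous_const
  exact h1.inter (h2.inter h3)

/-- By the uniform bound and uniqueness of the asymptotic direction, the graph is an intersection of
closed conditions, one for each `t ≥ 0`. A closed graph into a compact space gives continuity. -/
theorem continuous_translate (g : SpecialLinearGroup (Fin m) ℝ) :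
    Continuous (translate g : VisualSphere m → VisualSphere m) := by
  have hgraph : IsClosed {p : VisualSphere m × VisualSphere m | translate g p.1 = p.2} := by
    have : {p : VisualSphere m × VisualSphere m | translate g p.1 = p.2} =
        ⋂ (t : ℝ) (_ : 0 ≤ t), {p | frobSq ((expSL p.2 t)⁻¹ * g * expSL p.1 t).1 ≤ frobSq g.1} := by
      ext p
      simp only [Set.mem_iInter, Set.mem_ofPred_eq]
      constructor
      · intro h t ht
        rw [← h]
        exact (exists_translate g p.1).choose_spec t ht
      · exact fun h => (rayAsymptotic_of_frobSq_le h).translate_eq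
    rw [this]
    refine isClosed_iInter fun t => isClosed_iInter fun _ => isClosed_le ?_ continuous_const
    refine continuous_frobSq.comp (continuous_subtype_val.comp ?_)
    exact (((continuous_expSL t).comp continuous_snd).inv.mul continuous_const).mul
      ((continuous_expSL t).comp continuous_fst)
  rw [continuous_iff_isClosed]
  intro s hs
  have h := isClosedMap_fst_of_compactSpace _ (hgraph.inter (hs.preimage continuous_snd))
  convert h using 1
  ext Z
  constructor
  · exact fun hZ => ⟨(Z, translate g Z), ⟨rfl, hZ⟩, rfl⟩
  · rintro ⟨p, ⟨hp, hps⟩, rfl⟩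
    have hp' : translate g p.1 = p.2 := hp
    rw [Set.mem_preimage, hp']
    exact hps

/-- The action of an element of `SL_m(ℝ)` on the visual sphere is a homeomorphism. -/
noncomputable def translateHomeo (g : SpecialLinearGroup (Fin m) ℝ) :
    VisualSphere m ≃ₜ VisualSphere m where
  toFun := translate g
  invFun := translate g⁻¹
  left_inv Z := (rayAsymptotic_translate g Z).inv.translate_eq
  right_inv Z := by
    have := (rayAsymptotic_translate g⁻¹ Z).inv
    rw [inv_inv] at this
    exact this.translate_eq
  continuous_toFun := continuous_translate g
  continuous_invFun := continuous_translate g⁻¹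

theorem mem_sphereAtInfinity_iff {ι : Type} {U : ι → Submodule ℝ (Fin m → ℝ)} {ξ : VisualSphere m} :
    ξ ∈ sphereAtInfinity U ↔ ∃ (g : SpecialLinearGroup (Fin m) ℝ) (Z : VisualSphere m),
      (∀ t : ℝ, 0 ≤ t → geodesic g Z t ∈ symSubspace U) ∧ RayAsymptotic g Z ξ := by
  simp only [sphereAtInfinity, boundaryAtInfinity, Set.mem_ofPred_eq, asymptotic_geodesic_iff]

/-- Membership in a symmetric subspace, in terms of a representative. -/
theorem mk_mem_symSubspace_iff {ι : Type} {U : ι → Submodule ℝ (Fin m → ℝ)}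
    {a : SpecialLinearGroup (Fin m) ℝ} : (QuotientGroup.mk a : SymSpace m) ∈ symSubspace U ↔
      Pairwise fun i j => ∀ u ∈ U i, ∀ v ∈ U j, ((a⁻¹).1 *ᵥ u) ⬝ᵥ ((a⁻¹).1 *ᵥ v) = 0 := by
  have h : ∀ u v, innerAt (QuotientGroup.mk a : SymSpace m) u v =
      ((a⁻¹).1 *ᵥ u) ⬝ᵥ ((a⁻¹).1 *ᵥ v) := by
    intro u v
    have hinv : (a.1 * a.1ᵀ)⁻¹ = (a⁻¹).1ᵀ * (a⁻¹).1 := by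
      apply inv_eq_left_inv
      rw [mul_assoc, ← mul_assoc _ a.1, coe_inv_mul_coe, one_mul, ← transpose_mul, coe_mul_coe_inv,
        transpose_one]
    rw [innerAt, gram_mk, hinv, ← mulVec_mulVec, dotProduct_mulVec, vecMul_transpose]
  simp only [symSubspace, Set.mem_ofPred_eq, h]

theorem mul_mem_symSubspace_iff {ι : Type} {U : ι → Submodule ℝ (Fin m → ℝ)}
    {g a : SpecialLinearGroup (Fin m) ℝ} :
    (QuotientGroup.mk (g * a) : SymSpace m) ∈ symSubspace (fun i => (U i).map (mulVecLin g.1)) ↔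
      (QuotientGroup.mk a : SymSpace m) ∈ symSubspace U := by
  have h : ∀ u, ((g * a)⁻¹).1 *ᵥ (g.1 *ᵥ u) = (a⁻¹).1 *ᵥ u := by
    intro u
    rw [mulVec_mulVec]
    congr 1
    exact congrArg Subtype.val (by group : (g * a)⁻¹ * g = a⁻¹)
  simp only [mk_mem_symSubspace_iff, Submodule.mem_map, mulVecLin_apply, forall_exists_index, and_imp,
    forall_apply_eq_imp_iff₂, h]

theorem sphereAtInfinity_map {ι : Type} (U : ι → Submodule ℝ (Fin m → ℝ))
    (g : SpecialLinearGroup (Fin m) ℝ) :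
    sphereAtInfinity (fun i => (U i).map (mulVecLin g.1)) =
      translateHomeo g '' sphereAtInfinity U := by
  ext ξ
  constructor
  · intro h
    obtain ⟨a, Z, ha, hZ⟩ := mem_sphereAtInfinity_iff.mp h
    refine ⟨translate g⁻¹ ξ, mem_sphereAtInfinity_iff.mpr ⟨g⁻¹ * a, Z, fun t ht => ?_,
      hZ.trans (rayAsymptotic_translate g⁻¹ ξ)⟩, (translateHomeo g).right_inv ξ⟩
    rw [geodesic, ← mul_mem_symSubspace_iff (g := g), ← mul_assoc, mul_inv_cancel_left]
    exact ha t ht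
  · rintro ⟨ζ, hζ, rfl⟩
    obtain ⟨a, Z, ha, hZ⟩ := mem_sphereAtInfinity_iff.mp hζ
    refine mem_sphereAtInfinity_iff.mpr ⟨g * a, Z, fun t ht => ?_,
      hZ.trans (rayAsymptotic_translate g ζ)⟩
    rw [geodesic, mul_assoc, mul_mem_symSubspace_iff]
    exact ha t ht

end SLSymm

namespace SLSymm

open Matrix

variable {m : ℕ}

/-! ### Frames and hyperplanes at an adapted base point -/

/-- The hyperplane orthogonal to `φ`. -/
def orthHyperplane (φ : Fin m → ℝ) : Submodule ℝ (Fin m → ℝ) where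
  carrier := {v | φ ⬝ᵥ v = 0}
  add_mem' := fun {a b} (ha : φ ⬝ᵥ a = 0) (hb : φ ⬝ᵥ b = 0) => by
    rw [Set.mem_ofPred_eq, dotProduct_add, ha, hb, add_zero]
  zero_mem' := dotProduct_zero φ
  smul_mem' := fun c a (ha : φ ⬝ᵥ a = 0) => by
    rw [Set.mem_ofPred_eq, dotProduct_smul, ha, smul_zero]

theorem mem_orthHyperplane {φ v : Fin m → ℝ} : v ∈ orthHyperplane φ ↔ φ ⬝ᵥ v = 0 := Iff.rfl

/-- The coordinate axes. -/
def axis (i : Fin m) : Submodule ℝ (Fin m → ℝ) := ℝ ∙ (Pi.single i 1 : Fin m → ℝ)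

/-- The real exponential is injective, so for `t ≠ 0` distinct eigenvalues of `Z` remain distinct in
`exp (t Z)` and no eigenspaces merge. -/
theorem exists_eigenvalue_of_exp {Z : Matrix (Fin m) (Fin m) ℝ} (hZ : Z.IsSymm) {x : Fin m → ℝ}
    {κ t : ℝ} (ht : t ≠ 0) (hx : NormedSpace.exp (t • Z) *ᵥ x = κ • x) : ∃ l : ℝ, Z *ᵥ x = l • x := by
  obtain ⟨U, μ, hU, hU', rfl⟩ := exists_diagonalization hZ
  set c := Uᵀ *ᵥ x with hc
  have hd : diagonal (fun i => Real.exp (t * μ i)) *ᵥ c = κ • c := by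
    have := congrArg (Uᵀ *ᵥ ·) hx
    simp only [mulVec_smul] at this
    rwa [exp_smul_conj_diagonal hU, mulVec_mulVec, mul_assoc, ← mul_assoc, hU', one_mul,
      ← mulVec_mulVec, ← hc] at this
  have hd' : ∀ i, c i = 0 ∨ Real.exp (t * μ i) = κ := by
    intro i
    have := congrFun hd i
    rw [mulVec_diagonal, Pi.smul_apply, smul_eq_mul] at this
    exact (mul_eq_mul_right_iff.mp this).symm
  have key : ∃ l : ℝ, ∀ i, μ i * c i = l * c i := by
    by_cases h : ∃ i, c i ≠ 0
    · obtain ⟨i, hi⟩ := h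
      refine ⟨μ i, fun j => ?_⟩
      rcases hd' j with hj | hj
      · rw [hj, mul_zero, mul_zero]
      · have := Real.exp_injective (hj.trans ((hd' i).resolve_left hi).symm)
        rw [mul_left_cancel₀ ht this]
    · push Not at h
      exact ⟨0, fun i => by rw [h i, mul_zero, mul_zero]⟩
  obtain ⟨l, hl⟩ := key
  have hdl : diagonal μ *ᵥ c = l • c := by
    funext i
    rw [mulVec_diagonal, Pi.smul_apply, smul_eq_mul, hl]
  refine ⟨l, ?_⟩
  rw [mul_assoc, ← mulVec_mulVec, ← mulVec_mulVec, ← hc, hdl, mulVec_smul, hc, mulVec_mulVec, hU,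
    one_mulVec]

theorem exists_smul_eq_of_orthHyperplane_le {φ w : Fin m → ℝ} (hφ : φ ≠ 0)
    (h : ∀ v, φ ⬝ᵥ v = 0 → w ⬝ᵥ v = 0) : ∃ c : ℝ, w = c • φ := by
  have hφφ : φ ⬝ᵥ φ ≠ 0 := fun h0 => hφ (dotProduct_self_eq_zero.mp h0)
  refine ⟨(φ ⬝ᵥ w) / (φ ⬝ᵥ φ), ?_⟩
  set c := (φ ⬝ᵥ w) / (φ ⬝ᵥ φ) with hc
  have h1 : φ ⬝ᵥ (w - c • φ) = 0 := by
    rw [dotProduct_sub, dotProduct_smul, smul_eq_mul, hc, div_mul_cancel₀ _ hφφ, sub_self]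
  have h2 : (w - c • φ) ⬝ᵥ (w - c • φ) = 0 := by
    rw [sub_dotProduct, h _ h1, smul_dotProduct, h1, smul_zero, sub_zero]
  exact sub_eq_zero.mp (dotProduct_self_eq_zero.mp h2)

/-- A ray all of whose points make `l` orthogonal to the hyperplane `φ^⊥` converges to a point at
infinity at which the Rayleigh quotient of `φ` is at most that of `l`, with equality only for
common eigenvectors. -/
theorem RayAsymptotic.rayleigh_of_orthogonal {g : SpecialLinearGroup (Fin m) ℝ}
    {Z ξ : VisualSphere m} (h : RayAsymptotic g Z ξ) {l φ : Fin m → ℝ} (hl : l ≠ 0) (hφ : φ ≠ 0)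
    (horth : ∀ t : ℝ, 0 ≤ t → ∀ v, φ ⬝ᵥ v = 0 →
      (((g * expSL Z t)⁻¹).1 *ᵥ l) ⬝ᵥ (((g * expSL Z t)⁻¹).1 *ᵥ v) = 0) :
    ∃ c : ℝ, c * (l ⬝ᵥ l) ≤ l ⬝ᵥ ξ.1 *ᵥ l ∧ φ ⬝ᵥ ξ.1 *ᵥ φ ≤ c * (φ ⬝ᵥ φ) ∧
      (l ⬝ᵥ ξ.1 *ᵥ l = c * (l ⬝ᵥ l) → ξ.1 *ᵥ l = c • l) := by
  set x := (g⁻¹).1 *ᵥ l with hx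
  have hgx : g.1 *ᵥ x = l := by rw [hx, mulVec_mulVec, coe_mul_coe_inv, one_mulVec]
  set y := g.1ᵀ *ᵥ φ with hy
  have hx0 : x ≠ 0 := fun h0 => hl (by rw [← hgx, h0, mulVec_zero])
  have key : ∀ t : ℝ, 0 ≤ t → ∃ c : ℝ, NormedSpace.exp ((-(2 * t)) • Z.1) *ᵥ x = c • y := by
    intro t ht
    set n := (g * expSL Z t)⁻¹ with hn
    have hn' : n.1 = (expSL Z (-t)).1 * (g⁻¹).1 :=
      congrArg Subtype.val (show n = expSL Z (-t) * g⁻¹ by rw [hn, _root_.mul_inv_rev, expSL_inv])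
    -- Orthogonality says that `nᵀ n l` annihilates `φ^⊥`, so it is a multiple of `φ`; applying `gᵀ`
    -- gives the claim.
    obtain ⟨c, hc⟩ := exists_smul_eq_of_orthHyperplane_le (w := n.1ᵀ *ᵥ (n.1 *ᵥ l)) hφ
      fun v hv => by
        rw [mulVec_transpose, ← dotProduct_mulVec]
        exact horth t ht v hv
    refine ⟨c, ?_⟩
    have hgn : g.1ᵀ * n.1ᵀ = (expSL Z (-t)).1 := by
      rw [← transpose_mul, hn', mul_assoc, coe_inv_mul_coe, mul_one, expSL_transpose]
    have hee : (expSL Z (-t)).1 * (expSL Z (-t)).1 = NormedSpace.exp ((-(2 * t)) • Z.1) := by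
      rw [expSL_coe, ← Matrix.exp_add_of_commute _ _ (Commute.refl _), ← add_smul]
      congr 2; ring
    rw [hy, ← mulVec_smul, ← hc, mulVec_mulVec, mulVec_mulVec, hgn, hn', mulVec_mulVec,
      ← mul_assoc, hee]
  -- Time `0` shows that `x` and `y` are parallel; time `1` then makes `x` an eigenvector of `exp
  -- (-2 Z)`, hence of `Z`.
  obtain ⟨c₀, hc₀⟩ := key 0 le_rfl
  rw [mul_zero, neg_zero, zero_smul, NormedSpace.exp_zero, one_mulVec] at hc₀
  have hc₀0 : c₀ ≠ 0 := fun h0 => hx0 (by rw [hc₀, h0, zero_smul])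
  have hyx : y = c₀⁻¹ • x := by rw [hc₀, smul_smul, inv_mul_cancel₀ hc₀0, one_smul]
  obtain ⟨c₁, hc₁⟩ := key 1 zero_le_one
  rw [hyx, smul_smul] at hc₁
  obtain ⟨c, hc⟩ := exists_eigenvalue_of_exp Z.2.1 (by norm_num) hc₁
  have h1 := h.le_rayleigh hc
  rw [hgx] at h1
  have h2 := h.rayleigh_le (φ := φ) (l := c) (by
    rw [← hy, hyx, mulVec_smul, hc, smul_comm])
  exact ⟨c, h1.1, h2.1, h1.2⟩

/-- If `l` is an eigenvector of `Z`, it stays orthogonal to `l^⊥` along the ray of `Z`. -/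
theorem orthogonal_of_eigenvector (Z : VisualSphere m) {l v : Fin m → ℝ} {c : ℝ}
    (hl : Z.1 *ᵥ l = c • l) (hv : l ⬝ᵥ v = 0) (t : ℝ) :
    (((1 * expSL Z t)⁻¹).1 *ᵥ l) ⬝ᵥ (((1 * expSL Z t)⁻¹).1 *ᵥ v) = 0 := by
  rw [one_mul, expSL_inv, expSL_mulVec_of_eigenvector Z hl, smul_dotProduct, dotProduct_mulVec,
    ← mulVec_transpose, expSL_transpose, expSL_mulVec_of_eigenvector Z hl, smul_dotProduct, hv,
    smul_zero, smul_zero]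

theorem rayAsymptotic_one (Z : VisualSphere m) : RayAsymptotic 1 Z Z := by
  refine ⟨{1}, isCompact_singleton, fun t _ => ?_⟩
  rw [mul_one, inv_mul_cancel]
  rfl

/-! ### The two spheres -/

theorem rayleigh_of_mem_sphere {l φ : Fin m → ℝ} (hl : l ≠ 0) (hφ : φ ≠ 0) {ξ : VisualSphere m}
    (h : ξ ∈ sphereAtInfinity ![ℝ ∙ l, orthHyperplane φ]) :
    ∃ c : ℝ, c * (l ⬝ᵥ l) ≤ l ⬝ᵥ ξ.1 *ᵥ l ∧ φ ⬝ᵥ ξ.1 *ᵥ φ ≤ c * (φ ⬝ᵥ φ) ∧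
      (l ⬝ᵥ ξ.1 *ᵥ l = c * (l ⬝ᵥ l) → ξ.1 *ᵥ l = c • l) := by
  obtain ⟨g, Z, hg, hZ⟩ := mem_sphereAtInfinity_iff.mp h
  refine hZ.rayleigh_of_orthogonal hl hφ fun t ht v hv => ?_
  exact mk_mem_symSubspace_iff.mp (hg t ht) (show (0 : Fin 2) ≠ 1 by decide) l
    (Submodule.mem_span_singleton_self l) v hv

/-- With `φ = l` the two Rayleigh inequalities collapse to the equality case. Conversely, for an
eigenvector the ray from the base point already lies in the subspace. -/
theorem mem_sphere_self_iff {l : Fin m → ℝ} (hl : l ≠ 0) {ξ : VisualSphere m} :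
    ξ ∈ sphereAtInfinity ![ℝ ∙ l, orthHyperplane l] ↔ ∃ c : ℝ, ξ.1 *ᵥ l = c • l := by
  constructor
  · intro h
    obtain ⟨c, h1, h2, h3⟩ := rayleigh_of_mem_sphere hl hl h
    exact ⟨c, h3 (le_antisymm h2 h1)⟩
  · rintro ⟨c, hc⟩
    refine mem_sphereAtInfinity_iff.mpr ⟨1, ξ, fun t _ => mk_mem_symSubspace_iff.mpr ?_,
      rayAsymptotic_one ξ⟩
    have key : ∀ u ∈ ℝ ∙ l, ∀ v ∈ orthHyperplane l,
        (((1 * expSL ξ t)⁻¹).1 *ᵥ u) ⬝ᵥ (((1 * expSL ξ t)⁻¹).1 *ᵥ v) = 0 := by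
      intro u hu v hv
      obtain ⟨a, rfl⟩ := Submodule.mem_span_singleton.mp hu
      rw [mulVec_smul, smul_dotProduct, orthogonal_of_eigenvector ξ hc hv, smul_zero]
    intro i j hij
    fin_cases i <;> fin_cases j
    · exact absurd rfl hij
    · exact key
    · intro u hu v hv
      rw [dotProduct_comm]
      exact key v hv u hu
    · exact absurd rfl hij

theorem mem_sphere_axis_iff {ξ : VisualSphere m} :
    ξ ∈ sphereAtInfinity (axis (m := m)) ↔ ξ.1.IsDiag := by
  constructor
  · intro h
    obtain ⟨g, Z, hg, hZ⟩ := mem_sphereAtInfinity_iff.mp h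
    have key : ∀ j, ∃ c : ℝ, ξ.1 *ᵥ Pi.single j 1 = c • (Pi.single j 1 : Fin m → ℝ) := by
      intro j
      have h0 : (Pi.single j 1 : Fin m → ℝ) ≠ 0 := by simp
      -- The hyperplane orthogonal to one axis is spanned by the other axes, so the case `l = φ`
      -- applies to each axis.
      obtain ⟨c, h1, h2, h3⟩ := hZ.rayleigh_of_orthogonal h0 h0 fun t ht v hv => by
        have hv' : v = ∑ i, v i • (Pi.single i 1 : Fin m → ℝ) := pi_eq_sum_univ' v
        rw [hv', mulVec_sum, dotProduct_sum]
        refine Finset.sum_eq_zero fun i _ => ?_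
        by_cases hij : j = i
        · subst hij
          have : v j = 0 := by simpa using hv
          rw [this, zero_smul, mulVec_zero, dotProduct_zero]
        · rw [mulVec_smul, dotProduct_smul, mk_mem_symSubspace_iff.mp (hg t ht) hij _
            (Submodule.mem_span_singleton_self _) _ (Submodule.mem_span_singleton_self _), smul_zero]
      exact ⟨c, h3 (le_antisymm h2 h1)⟩
    intro i j hij
    obtain ⟨c, hc⟩ := key j
    have := congrFun hc i
    simpa [hij] using this
  · intro h
    refine mem_sphereAtInfinity_iff.mpr ⟨1, ξ, fun t _ => mk_mem_symSubspace_iff.mpr ?_,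
      rayAsymptotic_one ξ⟩
    intro i j hij u hu v hv
    obtain ⟨a, rfl⟩ := Submodule.mem_span_singleton.mp hu
    obtain ⟨b, rfl⟩ := Submodule.mem_span_singleton.mp hv
    have hi : ξ.1 *ᵥ Pi.single i 1 = ξ.1 i i • (Pi.single i 1 : Fin m → ℝ) := by
      funext k
      by_cases hk : k = i
      · subst hk; simp
      · simp [hk, h hk]
    rw [mulVec_smul, mulVec_smul, smul_dotProduct, dotProduct_smul,
      orthogonal_of_eigenvector ξ hi (by simp [hij]), smul_zero, smul_zero]

/-! ### Contractions along straight lines -/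

/-- Along the segment from a point of `A` to `X` the functional is positive at every positive time.
So the segment avoids the origin and, after normalisation, `B`; at time `0` disjointness takes over.
-/
theorem contractsIn_of_functional {A B : Set (VisualSphere m)} (hAB : Disjoint A B)
    (q : Matrix (Fin m) (Fin m) ℝ →ₗ[ℝ] ℝ) (hA : ∀ Z ∈ A, 0 ≤ q Z.1) (hB : ∀ Z ∈ B, q Z.1 ≤ 0)
    {X : Matrix (Fin m) (Fin m) ℝ} (hX : X ∈ symTraceless m) (hqX : 0 < q X) :
    ContractsIn A Bᶜ := by
  let f : unitInterval × A → Matrix (Fin m) (Fin m) ℝ := fun p =>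
    (1 - p.1 : ℝ) • p.2.1.1 + (p.1 : ℝ) • X
  have hf : Continuous f := by
    have h1 : Continuous fun p : unitInterval × A => (p.1 : ℝ) :=
      continuous_subtype_val.comp continuous_fst
    have h2 : Continuous fun p : unitInterval × A => p.2.1.1 :=
      continuous_subtype_val.comp (continuous_subtype_val.comp continuous_snd)
    exact ((continuous_const.sub h1).smul h2).add (h1.smul continuous_const)
  have hfs : ∀ p, f p ∈ symTraceless m := fun p =>
    add_mem (Submodule.smul_mem _ _ p.2.1.mem_symTraceless) (Submodule.smul_mem _ _ hX)
  have hqf : ∀ p, (p.1 : ℝ) ≠ 0 → 0 < q (f p) := by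
    intro p hp
    have h0 : 0 < (p.1 : ℝ) := lt_of_le_of_ne p.1.2.1 hp.symm
    have h1 := mul_nonneg (sub_nonneg.mpr p.1.2.2) (hA _ p.2.2)
    have h2 := mul_pos h0 hqX
    simp only [f, map_add, map_smul, smul_eq_mul]
    linarith
  have hf0 : ∀ p, f p ≠ 0 := by
    intro p h
    by_cases hp : (p.1 : ℝ) = 0
    · simp only [f, hp, sub_zero, one_smul, zero_smul, add_zero] at h
      exact p.2.1.ne_zero h
    · have := hqf p hp
      rw [h, map_zero] at this
      exact lt_irrefl _ this
  have hX0 : X ≠ 0 := fun h => by rw [h, map_zero] at hqX; exact lt_irrefl _ hqX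
  have hpos : ∀ (M : Matrix (Fin m) (Fin m) ℝ) (hM : M ∈ symTraceless m) (h0 : M ≠ 0), 0 < q M →
      normalize M hM h0 ∈ Bᶜ := by
    intro M hM h0 hq hB'
    have h1 := hB _ hB'
    have h2 : q (normalize M hM h0).1 = (√(frobSq M))⁻¹ * q M := by
      rw [normalize, map_smul, smul_eq_mul]
    have h3 : 0 < √(frobSq M) := Real.sqrt_pos.mpr
      (lt_of_le_of_ne (frobSq_nonneg _) (Ne.symm (frobSq_eq_zero.not.mpr h0)))
    rw [h2] at h1
    exact absurd (mul_pos (inv_pos.mpr h3) hq) (not_lt.mpr h1)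
  have hstart : ∀ a : A, normalize (f (0, a)) (hfs _) (hf0 _) = a := by
    intro a
    have : f (0, a) = a.1.1 := by simp [f]
    simp only [this]
    exact normalize_coe a.1
  refine contractsIn_of_homotopy (H := fun p => normalize (f p) (hfs p) (hf0 p))
    (y := normalize X hX hX0) (continuous_normalize hf hfs hf0) (hpos _ _ _ hqX) (fun p => ?_)
    hstart (fun a => ?_)
  · by_cases hp : (p.1 : ℝ) = 0
    · have : p = (0, p.2) := Prod.ext (Subtype.ext hp) rfl
      rw [this, hstart]
      exact Set.disjoint_left.mp hAB p.2.2
    · exact hpos _ _ _ (hqf p hp)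
  · have : f (1, a) = X := by simp [f]
    simp only [this]

/-- The difference of the quadratic forms at two vectors. -/
def quadDiff (φ l : Fin m → ℝ) : Matrix (Fin m) (Fin m) ℝ →ₗ[ℝ] ℝ where
  toFun M := φ ⬝ᵥ M *ᵥ φ - l ⬝ᵥ M *ᵥ l
  map_add' M N := by simp only [add_mulVec, dotProduct_add]; ring
  map_smul' c M := by
    simp only [smul_mulVec, dotProduct_smul, smul_eq_mul, RingHom.id_apply]; ring

theorem quadDiff_apply (φ l : Fin m → ℝ) (M : Matrix (Fin m) (Fin m) ℝ) :
    quadDiff φ l M = φ ⬝ᵥ M *ᵥ φ - l ⬝ᵥ M *ᵥ l := rfl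

/-! ### Linking when `|l i| = |φ i|`. -/

section NormalForm

variable {l φ : Fin m → ℝ}

theorem dotProduct_self_eq_of_abs (habs : ∀ i, |l i| = |φ i|) : l ⬝ᵥ l = φ ⬝ᵥ φ :=
  Finset.sum_congr rfl fun i _ => by
    rw [← abs_mul_abs_self, habs, abs_mul_abs_self]

theorem quadDiff_eq_zero_of_isDiag (habs : ∀ i, |l i| = |φ i|) {M : Matrix (Fin m) (Fin m) ℝ}
    (hM : M.IsDiag) : quadDiff φ l M = 0 := by
  obtain ⟨d, rfl⟩ : ∃ d, M = diagonal d := ⟨_, hM.diagonal_diag.symm⟩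
  rw [quadDiff_apply, sub_eq_zero]
  simp only [dotProduct, mulVec_diagonal]
  refine Finset.sum_congr rfl fun i _ => ?_
  have : φ i * φ i = l i * l i := by rw [← abs_mul_abs_self, ← habs, abs_mul_abs_self]
  linear_combination d i * this

theorem quadDiff_nonpos_of_mem (hl : ∀ i, l i ≠ 0) (hm : 0 < m) (habs : ∀ i, |l i| = |φ i|)
    {ξ : VisualSphere m} (h : ξ ∈ sphereAtInfinity ![ℝ ∙ l, orthHyperplane φ]) :
    quadDiff φ l ξ.1 ≤ 0 := by
  have hl0 : l ≠ 0 := fun h => hl ⟨0, hm⟩ (by rw [h]; rfl)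
  have hφ0 : φ ≠ 0 := fun h => hl ⟨0, hm⟩ (by have := habs ⟨0, hm⟩; rw [h] at this; simpa using this)
  obtain ⟨c, h1, h2, -⟩ := rayleigh_of_mem_sphere hl0 hφ0 h
  rw [dotProduct_self_eq_of_abs habs] at h1
  rw [quadDiff_apply]
  linarith

/-- A diagonal `ξ` has equal quadratic forms at `l` and `φ`, which forces the equality case, so `l`
is an eigenvector. As no coordinate of `l` vanishes, `ξ` is scalar, and being traceless it is zero.
-/
theorem disjoint_spheres (hl : ∀ i, l i ≠ 0) (hm : 0 < m) (habs : ∀ i, |l i| = |φ i|) :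
    Disjoint (sphereAtInfinity (axis (m := m))) (sphereAtInfinity ![ℝ ∙ l, orthHyperplane φ]) := by
  rw [Set.disjoint_left]
  intro ξ hA hB
  have hd := mem_sphere_axis_iff.mp hA
  have hl0 : l ≠ 0 := fun h => hl ⟨0, hm⟩ (by rw [h]; rfl)
  have hφ0 : φ ≠ 0 := fun h => hl ⟨0, hm⟩ (by have := habs ⟨0, hm⟩; rw [h] at this; simpa using this)
  obtain ⟨c, h1, h2, h3⟩ := rayleigh_of_mem_sphere hl0 hφ0 hB
  have h4 := quadDiff_eq_zero_of_isDiag habs hd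
  rw [quadDiff_apply] at h4
  rw [← dotProduct_self_eq_of_abs habs] at h2
  have h5 := h3 (le_antisymm (by linarith) h1)
  obtain ⟨d, hdd⟩ : ∃ d, ξ.1 = diagonal d := ⟨_, hd.diagonal_diag.symm⟩
  have h6 : ∀ i, d i = c := by
    intro i
    have := congrFun h5 i
    rw [hdd, mulVec_diagonal, Pi.smul_apply, smul_eq_mul] at this
    exact mul_right_cancel₀ (hl i) this
  have htr := ξ.2.2.1
  rw [hdd, trace_diagonal, Finset.sum_congr rfl fun i _ => h6 i, Finset.sum_const, Finset.card_univ,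
    Fintype.card_fin, nsmul_eq_mul] at htr
  have hc : c = 0 := (mul_eq_zero.mp htr).resolve_left (by exact_mod_cast hm.ne')
  apply ξ.ne_zero
  rw [hdd, diagonal_eq_zero]
  funext i
  rw [h6 i, hc]; rfl

/-- Strict Cauchy-Schwarz: `|l k * φ k| = l k ^ 2` for each `k`, and two opposite signs make the sum
cancel in part. -/
theorem abs_dotProduct_lt {i j : Fin m} (hi : 0 < l i * φ i) (hj : l j * φ j < 0)
    (habs : ∀ i, |l i| = |φ i|) : |l ⬝ᵥ φ| < l ⬝ᵥ l := by
  have hk : ∀ k, |l k * φ k| = l k * l k := fun k => by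
    rw [abs_mul, ← habs, abs_mul_abs_self]
  rw [abs_lt]
  constructor
  · rw [neg_lt, dotProduct, ← Finset.sum_neg_distrib]
    refine Finset.sum_lt_sum (fun k _ => ?_) ⟨i, Finset.mem_univ i, ?_⟩
    · rw [← hk]; exact neg_le_abs _
    · rw [← hk]
      exact (neg_lt_zero.mpr hi).trans_le (abs_nonneg _)
  · refine Finset.sum_lt_sum (fun k _ => ?_) ⟨j, Finset.mem_univ j, ?_⟩
    · rw [← hk]; exact le_abs_self _
    · rw [← hk]
      exact hj.trans_le (abs_nonneg _)

theorem contractsIn_of_opposite_signs (hl : ∀ i, l i ≠ 0) (hm : 0 < m) (habs : ∀ i, |l i| = |φ i|)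
    {i j : Fin m} (hi : 0 < l i * φ i) (hj : l j * φ j < 0) :
    ContractsIn (sphereAtInfinity (axis (m := m)))
        (sphereAtInfinity ![ℝ ∙ l, orthHyperplane φ])ᶜ ∧
      ContractsIn (sphereAtInfinity ![ℝ ∙ l, orthHyperplane φ])
        (sphereAtInfinity (axis (m := m)))ᶜ := by
  -- Equal norms make `X` traceless, and `quadDiff φ l X = 2 * ((l ⬝ᵥ l) ^ 2 - (l ⬝ᵥ φ) ^ 2)`.
  set X := vecMulVec φ φ - vecMulVec l l with hX
  have hXmem : X ∈ symTraceless m := by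
    constructor
    · rw [IsSymm, hX, transpose_sub, transpose_vecMulVec, transpose_vecMulVec]
    · rw [hX, trace_sub, trace_vecMulVec, trace_vecMulVec, dotProduct_self_eq_of_abs habs, sub_self]
  have hqX : 0 < quadDiff φ l X := by
    have h1 := abs_dotProduct_lt hi hj habs
    have h2 : (l ⬝ᵥ φ) ^ 2 < (l ⬝ᵥ l) ^ 2 := by
      rw [sq_lt_sq]
      exact h1.trans_le (le_abs_self _)
    have hv : ∀ a b : Fin m → ℝ, a ⬝ᵥ vecMulVec b b *ᵥ a = (a ⬝ᵥ b) ^ 2 := fun a b => by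
      rw [vecMulVec_mulVec, op_smul_eq_smul, dotProduct_smul, smul_eq_mul, dotProduct_comm b a, sq]
    rw [quadDiff_apply, hX, sub_mulVec, sub_mulVec, dotProduct_sub, dotProduct_sub, hv, hv, hv, hv,
      dotProduct_comm φ l, ← dotProduct_self_eq_of_abs habs]
    linarith
  have hdisj := disjoint_spheres hl hm habs
  constructor
  · exact contractsIn_of_functional hdisj (quadDiff φ l)
      (fun Z hZ => (quadDiff_eq_zero_of_isDiag habs (mem_sphere_axis_iff.mp hZ)).ge)
      (fun Z hZ => quadDiff_nonpos_of_mem hl hm habs hZ) hXmem hqX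
  · refine contractsIn_of_functional hdisj.symm (-quadDiff φ l)
      (fun Z hZ => neg_nonneg.mpr (quadDiff_nonpos_of_mem hl hm habs hZ))
      (fun Z hZ => (neg_eq_zero.mpr
        (quadDiff_eq_zero_of_isDiag habs (mem_sphere_axis_iff.mp hZ))).le)
      (neg_mem hXmem) ?_
    rwa [LinearMap.neg_apply, map_neg, neg_neg]

/-- The projection onto traceless diagonal matrices whose kernel consists of the matrices with
eigenvector `l`. -/
noncomputable def diagProjection (l : Fin m → ℝ) :
    Matrix (Fin m) (Fin m) ℝ →ₗ[ℝ] Matrix (Fin m) (Fin m) ℝ where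
  -- When no `l i` vanishes, the ratios `(Z l) i / l i` are all equal exactly when `l` is an
  -- eigenvector; subtracting their mean makes the trace zero.
  toFun Z := diagonal fun i => (Z *ᵥ l) i / l i - (∑ j, (Z *ᵥ l) j / l j) / m
  map_add' Z W := by
    rw [diagonal_add]
    congr 1
    funext i
    simp only [add_mulVec, Pi.add_apply, add_div, Finset.sum_add_distrib]
    ring
  map_smul' c Z := by
    rw [RingHom.id_apply, ← diagonal_smul]
    congr 1
    funext i
    simp only [smul_mulVec, Pi.smul_apply, smul_eq_mul, mul_div_assoc, ← Finset.mul_sum]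
    ring

theorem diagProjection_apply (l : Fin m → ℝ) (Z : Matrix (Fin m) (Fin m) ℝ) :
    diagProjection l Z =
      diagonal fun i => (Z *ᵥ l) i / l i - (∑ j, (Z *ᵥ l) j / l j) / m := rfl

theorem diagProjection_mem (hm : 0 < m) (l : Fin m → ℝ) (Z : Matrix (Fin m) (Fin m) ℝ) :
    diagProjection l Z ∈ symTraceless m := by
  refine ⟨isSymm_diagonal _, ?_⟩
  have : (m : ℝ) ≠ 0 := by exact_mod_cast hm.ne'
  rw [diagProjection_apply, trace_diagonal, Finset.sum_sub_distrib, Finset.sum_const,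
    Finset.card_univ, Fintype.card_fin, nsmul_eq_mul, mul_div_cancel₀ _ this, sub_self]

theorem diagProjection_of_isDiag (hl : ∀ i, l i ≠ 0) {Z : Matrix (Fin m) (Fin m) ℝ} (hZ : Z.IsDiag)
    (htr : Z.trace = 0) : diagProjection l Z = Z := by
  obtain ⟨d, rfl⟩ : ∃ d, Z = diagonal d := ⟨_, hZ.diagonal_diag.symm⟩
  have hd : ∀ i, (diagonal d *ᵥ l) i / l i = d i := fun i => by
    rw [mulVec_diagonal, mul_div_cancel_right₀ _ (hl i)]
  rw [trace_diagonal] at htr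
  rw [diagProjection_apply]
  simp only [hd, htr, zero_div, sub_zero]

theorem diagProjection_eq_zero_iff (hl : ∀ i, l i ≠ 0) (hm : 0 < m)
    {Z : Matrix (Fin m) (Fin m) ℝ} : diagProjection l Z = 0 ↔ ∃ c : ℝ, Z *ᵥ l = c • l := by
  have hm' : (m : ℝ) ≠ 0 := by exact_mod_cast hm.ne'
  rw [diagProjection_apply, diagonal_eq_zero]
  constructor
  · intro h
    refine ⟨(∑ j, (Z *ᵥ l) j / l j) / m, funext fun i => ?_⟩
    have := congrFun h i
    rw [Pi.smul_apply, smul_eq_mul, ← sub_eq_zero.mp this, div_mul_cancel₀ _ (hl i)]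
  · rintro ⟨c, hc⟩
    funext i
    have hd : ∀ i, (c • l) i / l i = c := fun i => by
      rw [Pi.smul_apply, smul_eq_mul, mul_div_cancel_right₀ _ (hl i)]
    simp only [hc, hd, Finset.sum_const, Finset.card_univ, Fintype.card_fin, nsmul_eq_mul,
      mul_div_cancel_left₀ _ hm', sub_self]
    rfl

/-- The spheres belong to the image and kernel of `diagProjection l`; its complementary projection
exchanges their roles and gives the other order. -/
theorem not_contractsIn_spheres (hl : ∀ i, l i ≠ 0) (hm : 0 < m) :
    ¬ ContractsIn (sphereAtInfinity (axis (m := m)))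
        (sphereAtInfinity ![ℝ ∙ l, orthHyperplane l])ᶜ ∧
      ¬ ContractsIn (sphereAtInfinity ![ℝ ∙ l, orthHyperplane l])
        (sphereAtInfinity (axis (m := m)))ᶜ := by
  have hl0 : l ≠ 0 := fun h => hl ⟨0, hm⟩ (by rw [h]; rfl)
  have hA : sphereAtInfinity (axis (m := m)) =
      {Z : VisualSphere m | diagProjection l Z.1 = Z.1} := by
    ext Z
    rw [mem_sphere_axis_iff]
    exact ⟨fun h => diagProjection_of_isDiag hl h Z.2.2.1, fun h => by
      have h' : diagProjection l Z.1 = Z.1 := h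
      rw [← h']; exact isDiag_diagonal _⟩
  have hB : sphereAtInfinity ![ℝ ∙ l, orthHyperplane l] =
      {Z : VisualSphere m | diagProjection l Z.1 = 0} := by
    ext Z
    rw [mem_sphere_self_iff hl0]
    exact (diagProjection_eq_zero_iff hl hm).symm
  have hidem : ∀ Z, diagProjection l (diagProjection l Z) = diagProjection l Z := fun Z =>
    diagProjection_of_isDiag hl (isDiag_diagonal _) (diagProjection_mem hm l Z).2
  constructor
  · rw [hA, hB]
    exact not_contractsIn_of_projection _ (fun Z _ => diagProjection_mem hm l Z) fun Z _ => hidem Z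
  · let r : Matrix (Fin m) (Fin m) ℝ →ₗ[ℝ] Matrix (Fin m) (Fin m) ℝ :=
      LinearMap.id - diagProjection l
    have h := not_contractsIn_of_projection r
      (fun Z hZ => sub_mem hZ (diagProjection_mem hm l Z)) (fun Z _ => by
        simp only [r, LinearMap.sub_apply, LinearMap.id_apply, map_sub, hidem, sub_self, sub_zero])
    have hA' : {Z : VisualSphere m | diagProjection l Z.1 = Z.1} =
        {Z : VisualSphere m | r Z.1 = 0} := by
      ext Z
      exact ⟨fun h => sub_eq_zero.mpr (Eq.symm h), fun h => (sub_eq_zero.mp h).symm⟩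
    have hB' : {Z : VisualSphere m | diagProjection l Z.1 = 0} =
        {Z : VisualSphere m | r Z.1 = Z.1} := by
      ext Z
      exact sub_eq_self.symm
    rwa [hA, hB, hA', hB']

/-- Linking of the two spheres at an adapted base point. -/
theorem links_normal_form (hm : 0 < m) (hl : ∀ i, l i ≠ 0) (habs : ∀ i, |l i| = |φ i|) :
    (Links (sphereAtInfinity (axis (m := m))) (sphereAtInfinity ![ℝ ∙ l, orthHyperplane φ]) ↔
        (∀ i, 0 < l i * φ i) ∨ ∀ i, l i * φ i < 0) ∧
      (Links (sphereAtInfinity ![ℝ ∙ l, orthHyperplane φ]) (sphereAtInfinity (axis (m := m))) ↔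
        (∀ i, 0 < l i * φ i) ∨ ∀ i, l i * φ i < 0) := by
  have hdisj := disjoint_spheres hl hm habs
  have hne : ∀ i, l i * φ i ≠ 0 := fun i =>
    mul_ne_zero (hl i) (abs_ne_zero.mp (habs i ▸ abs_ne_zero.mpr (hl i)))
  by_cases h : (∀ i, 0 < l i * φ i) ∨ ∀ i, l i * φ i < 0
  · have hP : orthHyperplane φ = orthHyperplane l := by
      have hφ : φ = l ∨ φ = -l := by
        rcases h with h | h
        · refine Or.inl (funext fun i => ?_)
          rcases abs_eq_abs.mp (habs i) with hi | hi
          · exact hi.symm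
          · have := h i
            rw [hi] at this
            nlinarith [sq_nonneg (φ i)]
        · refine Or.inr (funext fun i => ?_)
          rcases abs_eq_abs.mp (habs i) with hi | hi
          · have := h i
            rw [hi] at this
            nlinarith [sq_nonneg (φ i)]
          · rw [Pi.neg_apply, hi, neg_neg]
      ext v
      rcases hφ with hφ | hφ
      · rw [hφ]
      · rw [mem_orthHyperplane, mem_orthHyperplane, hφ, neg_dotProduct, neg_eq_zero]
    rw [hP] at hdisj ⊢
    have hn := not_contractsIn_spheres hl hm
    exact ⟨iff_of_true ⟨hdisj, hn.1⟩ h, iff_of_true ⟨hdisj.symm, hn.2⟩ h⟩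
  · have h' := h
    push Not at h'
    obtain ⟨⟨j, hj⟩, i, hi⟩ := h'
    have hc := contractsIn_of_opposite_signs hl hm habs (lt_of_le_of_ne hi (hne i).symm)
      (lt_of_le_of_ne hj (hne j))
    exact ⟨iff_of_false (fun hL => hL.2 hc.1) h, iff_of_false (fun hL => hL.2 hc.2) h⟩

end NormalForm

end SLSymm

namespace SLSymm

open Matrix

variable {m : ℕ}

/-! ### Projective simplices -/

theorem mem_projPoints {W : Submodule ℝ (Fin m → ℝ)} {x : ℙ ℝ (Fin m → ℝ)} :
    x ∈ projPoints W ↔ x.rep ∈ W := by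
  rw [projPoints, Set.mem_ofPred_eq, Projectivization.submodule_eq, Submodule.span_singleton_le_iff_mem]

theorem mk'_mem_projPoints {W : Submodule ℝ (Fin m → ℝ)} {v : {v : Fin m → ℝ // v ≠ 0}} :
    Projectivization.mk' ℝ v ∈ projPoints W ↔ v.1 ∈ W := by
  rw [projPoints, Set.mem_ofPred_eq, Projectivization.mk'_eq_mk, Projectivization.submodule_mk,
    Submodule.span_singleton_le_iff_mem]

section Frame

variable {Ls : Fin m → ℙ ℝ (Fin m → ℝ)} (b : Module.Basis (Fin m) ℝ (Fin m → ℝ))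

theorem mem_faceHyperplane_iff (hb : ∀ i, (Ls i).submodule = ℝ ∙ b i) {i : Fin m} {v : Fin m → ℝ} :
    v ∈ faceHyperplane Ls i ↔ b.repr v i = 0 := by
  constructor
  · intro h
    have hle : faceHyperplane Ls i ≤ LinearMap.ker (b.coord i) := by
      refine iSup₂_le fun j hj => ?_
      rw [hb, Submodule.span_singleton_le_iff_mem, LinearMap.mem_ker, Module.Basis.coord_apply,
        Module.Basis.repr_self, Finsupp.single_eq_of_ne hj.symm]
    exact hle h
  · intro h
    rw [← b.sum_repr v]
    refine Submodule.sum_mem _ fun j _ => ?_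
    by_cases hj : j = i
    · rw [hj, h, zero_smul]; exact Submodule.zero_mem _
    · refine Submodule.smul_mem _ _ ?_
      have h1 : b j ∈ (Ls j).submodule := by rw [hb]; exact Submodule.mem_span_singleton_self _
      exact Submodule.mem_iSup_of_mem j (Submodule.mem_iSup_of_mem hj h1)

theorem mk'_mem_faceComplement_iff (hb : ∀ i, (Ls i).submodule = ℝ ∙ b i)
    {v : {v : Fin m → ℝ // v ≠ 0}} :
    Projectivization.mk' ℝ v ∈ faceComplement Ls ↔ ∀ i, b.repr v.1 i ≠ 0 := by
  simp only [faceComplement, Set.mem_compl_iff, Set.mem_iUnion, mk'_mem_projPoints,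
    mem_faceHyperplane_iff b hb, not_exists, ne_eq]

theorem mem_faceComplement_iff (hb : ∀ i, (Ls i).submodule = ℝ ∙ b i) {x : ℙ ℝ (Fin m → ℝ)} :
    x ∈ faceComplement Ls ↔ ∀ i, b.repr x.rep i ≠ 0 := by
  simp only [faceComplement, Set.mem_compl_iff, Set.mem_iUnion, mem_projPoints,
    mem_faceHyperplane_iff b hb, not_exists, ne_eq]

/-- The open simplex spanned by a basis. -/
def openSimplex : Set (ℙ ℝ (Fin m → ℝ)) :=
  {x | ∃ c : Fin m → ℝ, (∀ i, 0 < c i) ∧ ∑ i, c i • b i ∈ x.submodule}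

theorem mk'_mem_openSimplex_iff {v : {v : Fin m → ℝ // v ≠ 0}} :
    Projectivization.mk' ℝ v ∈ openSimplex b ↔
      (∀ i, 0 < b.repr v.1 i) ∨ ∀ i, b.repr v.1 i < 0 := by
  rw [openSimplex, Set.mem_ofPred_eq, Projectivization.mk'_eq_mk, Projectivization.submodule_mk]
  constructor
  · rintro ⟨c, hc, h⟩
    obtain ⟨a, ha⟩ := Submodule.mem_span_singleton.mp h
    have hrep : ∀ i, a * b.repr v.1 i = c i := fun i => by
      have := congrArg (fun u => b.repr u i) ha
      simpa only [map_smul, Finsupp.smul_apply, smul_eq_mul, b.repr_sum_self] using this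
    rcases le_total 0 a with ha0 | ha0
    · exact Or.inl fun i => pos_of_mul_pos_right (hrep i ▸ hc i) ha0
    · exact Or.inr fun i => by
        by_contra hn
        have := mul_nonpos_of_nonpos_of_nonneg ha0 (not_lt.mp hn)
        rw [hrep] at this
        exact absurd (hc i) (not_lt.mpr this)
  · rintro (h | h)
    · exact ⟨b.repr v.1, h, by rw [b.sum_repr]; exact Submodule.mem_span_singleton_self _⟩
    · refine ⟨fun i => -b.repr v.1 i, fun i => neg_pos.mpr (h i), ?_⟩
      simp only [neg_smul, Finset.sum_neg_distrib, b.sum_repr]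
      exact Submodule.neg_mem _ (Submodule.mem_span_singleton_self _)

theorem continuous_repr (i : Fin m) :
    Continuous fun v : {v : Fin m → ℝ // v ≠ 0} => b.repr v.1 i :=
  (LinearMap.continuous_of_finiteDimensional (b.coord i)).comp continuous_subtype_val

theorem isOpen_projectivization_iff {s : Set (ℙ ℝ (Fin m → ℝ))} :
    IsOpen s ↔ IsOpen (Projectivization.mk' ℝ ⁻¹' s) := isOpen_coinduced

theorem continuous_projectivization_mk' :
    Continuous (Projectivization.mk' ℝ : {v : Fin m → ℝ // v ≠ 0} → ℙ ℝ (Fin m → ℝ)) :=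
  continuous_coinduced_rng

theorem isOpen_openSimplex : IsOpen (openSimplex b) := by
  have : Projectivization.mk' ℝ ⁻¹' openSimplex b =
      (⋂ i, {v : {v : Fin m → ℝ // v ≠ 0} | 0 < b.repr v.1 i}) ∪ ⋂ i, {v | b.repr v.1 i < 0} := by
    ext v
    simp only [Set.mem_preimage, mk'_mem_openSimplex_iff, Set.mem_union, Set.mem_iInter,
      Set.mem_ofPred_eq]
  rw [isOpen_projectivization_iff, this]
  exact (isOpen_iInter_of_finite fun i => isOpen_lt continuous_const (continuous_repr b i)).union
    (isOpen_iInter_of_finite fun i => isOpen_lt (continuous_repr b i) continuous_const)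

/-- Off the faces no coordinate vanishes, so lying outside the simplex means that both signs occur,
an open condition. -/
theorem isOpen_faceComplement_diff (hb : ∀ i, (Ls i).submodule = ℝ ∙ b i) :
    IsOpen (faceComplement Ls \ openSimplex b) := by
  have : Projectivization.mk' ℝ ⁻¹' (faceComplement Ls \ openSimplex b) =
      (⋂ i, {v : {v : Fin m → ℝ // v ≠ 0} | b.repr v.1 i ≠ 0}) ∩
        ((⋃ i, {v | b.repr v.1 i < 0}) ∩ ⋃ i, {v | 0 < b.repr v.1 i}) := by
    ext v
    simp only [Set.preimage_sdiff, Set.mem_sdiff, Set.mem_preimage, mk'_mem_openSimplex_iff,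
      mk'_mem_faceComplement_iff b hb, Set.mem_inter_iff, Set.mem_iInter, Set.mem_iUnion,
      Set.mem_ofPred_eq, not_or, not_forall, not_lt]
    refine and_congr_right fun h => and_congr ?_ ?_
    · exact exists_congr fun i => ⟨fun hi => lt_of_le_of_ne hi (h i), le_of_lt⟩
    · exact exists_congr fun i => ⟨fun hi => lt_of_le_of_ne hi (h i).symm, le_of_lt⟩
  rw [isOpen_projectivization_iff, this]
  refine (isOpen_iInter_of_finite fun i => isOpen_ne_fun (continuous_repr b i)
    continuous_const).inter (IsOpen.inter ?_ ?_)
  · exact isOpen_iUnion fun i => isOpen_lt (continuous_repr b i) continuous_const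
  · exact isOpen_iUnion fun i => isOpen_lt continuous_const (continuous_repr b i)

theorem openSimplex_subset (hb : ∀ i, (Ls i).submodule = ℝ ∙ b i) :
    openSimplex b ⊆ faceComplement Ls := by
  intro x
  induction x using Projectivization.ind with
  | h v hv =>
    have h1 := mk'_mem_openSimplex_iff b (v := ⟨v, hv⟩)
    have h2 := mk'_mem_faceComplement_iff b hb (v := ⟨v, hv⟩)
    rw [Projectivization.mk'_eq_mk] at h1 h2
    rw [h1, h2]
    rintro (h | h)
    · exact fun i => (h i).ne'
    · exact fun i => (h i).ne

theorem isPreconnected_openSimplex (hm : 0 < m) : IsPreconnected (openSimplex b) := by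
  have hne : ∀ c : {c : Fin m → ℝ // ∀ i, 0 < c i}, ∑ i, c.1 i • b i ≠ 0 := by
    intro c h
    have := congrArg (fun u => b.repr u ⟨0, hm⟩) h
    simp only [b.repr_sum_self, map_zero, Finsupp.zero_apply] at this
    exact (c.2 _).ne' this
  have hconv : Convex ℝ {c : Fin m → ℝ | ∀ i, 0 < c i} := by
    intro x hx y hy s t hs ht hst i
    rcases hs.eq_or_lt with rfl | hs
    · rw [zero_add] at hst
      simpa [hst] using hy i
    · have h1 := mul_pos hs (hx i)
      have h2 := mul_nonneg ht (hy i).le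
      simp only [Pi.add_apply, Pi.smul_apply, smul_eq_mul]
      linarith
  have _ : PreconnectedSpace {c : Fin m → ℝ // ∀ i, 0 < c i} :=
    Subtype.preconnectedSpace hconv.isPreconnected
  have hcont : Continuous fun c : {c : Fin m → ℝ // ∀ i, 0 < c i} =>
      Projectivization.mk' ℝ (⟨∑ i, c.1 i • b i, hne c⟩ : {v : Fin m → ℝ // v ≠ 0}) := by
    refine continuous_projectivization_mk'.comp (Continuous.subtype_mk ?_ _)
    exact continuous_finsetSum _ fun i _ =>
      ((continuous_apply i).comp continuous_subtype_val).smul continuous_const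
  convert isPreconnected_range hcont using 1
  ext x
  constructor
  · rintro ⟨c, hc, hx⟩
    refine ⟨⟨c, hc⟩, Projectivization.submodule_injective ?_⟩
    change (Projectivization.mk ℝ (∑ i, c i • b i) (hne ⟨c, hc⟩)).submodule = _
    rw [Projectivization.submodule_mk]
    refine Submodule.eq_of_le_of_finrank_eq ((Submodule.span_singleton_le_iff_mem _ _).mpr hx) ?_
    rw [finrank_span_singleton (hne ⟨c, hc⟩), Projectivization.finrank_submodule]
  · rintro ⟨c, rfl⟩
    refine ⟨c.1, c.2, ?_⟩
    change _ ∈ (Projectivization.mk ℝ (∑ i, c.1 i • b i) (hne c)).submodule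
    rw [Projectivization.submodule_mk]
    exact Submodule.mem_span_singleton_self _

/-- The simplex is connected, as an image of the positive orthant, and both it and the rest of the
face complement are open. -/
theorem connectedComponentIn_faceComplement (hm : 0 < m) (hb : ∀ i, (Ls i).submodule = ℝ ∙ b i)
    {x : ℙ ℝ (Fin m → ℝ)} (hx : ∑ i, b i ∈ x.submodule) :
    connectedComponentIn (faceComplement Ls) x = openSimplex b := by
  have hxs : x ∈ openSimplex b := ⟨1, fun _ => zero_lt_one, by simpa using hx⟩
  have hsub := openSimplex_subset b hb
  refine Set.Subset.antisymm ?_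
    ((isPreconnected_openSimplex b hm).subset_connectedComponentIn hxs hsub)
  refine isPreconnected_connectedComponentIn.subset_left_of_subset_union (isOpen_openSimplex b)
    (isOpen_faceComplement_diff b hb) Set.disjoint_sdiff_right ?_
    ⟨x, mem_connectedComponentIn (hsub hxs), hxs⟩
  rw [Set.union_sdiff_cancel hsub]
  exact connectedComponentIn_subset _ _

/-- A point off the faces is the barycentre of a suitably rescaled basis. -/
theorem exists_adapted_basis (hb : ∀ i, (Ls i).submodule = ℝ ∙ b i) {x : ℙ ℝ (Fin m → ℝ)}
    (hx : x ∈ faceComplement Ls) : ∃ b' : Module.Basis (Fin m) ℝ (Fin m → ℝ),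
      (∀ i, (Ls i).submodule = ℝ ∙ b' i) ∧ ∑ i, b' i = x.rep := by
  have hx' := (mem_faceComplement_iff b hb).mp hx
  refine ⟨b.isUnitSMul fun i => (hx' i).isUnit, fun i => ?_, ?_⟩
  · rw [Module.Basis.isUnitSMul_apply, Submodule.span_singleton_smul_eq (hx' i).isUnit, hb]
  · simp only [Module.Basis.isUnitSMul_apply, b.sum_repr]

end Frame

theorem exists_basis_of_independent {Ls : Fin m → ℙ ℝ (Fin m → ℝ)}
    (h : Projectivization.Independent Ls) :
    ∃ b : Module.Basis (Fin m) ℝ (Fin m → ℝ), ∀ i, (Ls i).submodule = ℝ ∙ b i := by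
  classical
  refine ⟨basisOfPiSpaceOfLinearIndependent (Projectivization.independent_iff.mp h), fun i => ?_⟩
  rw [coe_basisOfPiSpaceOfLinearIndependent, Projectivization.submodule_eq]
  rfl

/-- A linear form with non-zero coefficients has no zero with positive coordinates if and only if
its coefficients have the same sign. -/
theorem no_positive_zero_iff (hm : 0 < m) {a : Fin m → ℝ} (ha : ∀ i, a i ≠ 0) :
    (∀ c : Fin m → ℝ, (∀ i, 0 < c i) → ∑ i, c i * a i ≠ 0) ↔ (∀ i, 0 < a i) ∨ ∀ i, a i < 0 := by
  have hne : (Finset.univ : Finset (Fin m)).Nonempty := ⟨⟨0, hm⟩, Finset.mem_univ _⟩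
  constructor
  · intro h
    by_contra hcon
    push Not at hcon
    obtain ⟨⟨j, hj⟩, i, hi⟩ := hcon
    -- Starting from all coefficients `1`, raising the one at an index whose sign opposes the total
    -- makes the sum vanish.
    obtain ⟨k, hk⟩ : ∃ k, (∑ i, a i) / a k ≤ 0 := by
      rcases le_total 0 (∑ i, a i) with hS | hS
      · exact ⟨j, div_nonpos_of_nonneg_of_nonpos hS hj⟩
      · exact ⟨i, div_nonpos_of_nonpos_of_nonneg hS hi⟩
    refine h (fun l => 1 + (if l = k then -((∑ i, a i) / a k) else 0)) (fun l => ?_) ?_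
    · split_ifs <;> linarith
    · simp only [add_mul, one_mul, ite_mul, zero_mul, Finset.sum_add_distrib, Finset.sum_ite_eq',
        Finset.mem_univ, if_true, neg_mul, div_mul_cancel₀ _ (ha k), add_neg_cancel]
  · rintro (h | h) c hc
    · exact (Finset.sum_pos (fun i _ => mul_pos (hc i) (h i)) hne).ne'
    · exact (Finset.sum_neg (fun i _ => mul_neg_of_pos_of_neg (hc i) (h i)) hne).ne

/-- An `m`-th root adjusts the size of the product, and the sign of `d` is placed on one coordinate.
This lets the adapted frame be reached within `SL_m(ℝ)`. -/
theorem exists_prod_eq (hm : 0 < m) {d : ℝ} (hd : d ≠ 0) {p : Fin m → ℝ} (hp : ∀ i, 0 < p i) :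
    ∃ (κ : ℝ) (r : Fin m → ℝ), 0 < κ ∧ (∀ i, |r i| = κ * p i) ∧ ∏ i, r i = d := by
  have hP : 0 < ∏ i, p i := Finset.prod_pos fun i _ => hp i
  have hx : 0 < |d| / ∏ i, p i := div_pos (abs_pos.mpr hd) hP
  set κ := (|d| / ∏ i, p i) ^ ((m : ℝ)⁻¹) with hκ
  have hκ0 : 0 < κ := Real.rpow_pos_of_pos hx _
  have hκm : κ ^ m = |d| / ∏ i, p i := Real.rpow_inv_natCast_pow hx.le hm.ne'
  have hsign : |(SignType.sign d : ℝ)| = 1 := by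
    rcases lt_or_gt_of_ne hd with h | h <;> simp [h]
  refine ⟨κ, fun i => κ * p i * (if i = ⟨0, hm⟩ then (SignType.sign d : ℝ) else 1), hκ0,
    fun i => ?_, ?_⟩
  · rw [abs_mul, abs_of_pos (mul_pos hκ0 (hp i))]
    split_ifs
    · rw [hsign, mul_one]
    · rw [abs_one, mul_one]
  · rw [Finset.prod_mul_distrib, Finset.prod_mul_distrib, Finset.prod_const, Finset.card_univ,
      Fintype.card_fin, hκm, Finset.prod_ite_eq', if_pos (Finset.mem_univ _),
      div_mul_cancel₀ _ hP.ne', abs_mul_sign]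

/-- Every frame with a point and a hyperplane in general position is the translate of one which is
adapted to the standard base point. -/
theorem exists_adapted_translate (hm : 0 < m) (b : Module.Basis (Fin m) ℝ (Fin m → ℝ))
    (f : (Fin m → ℝ) →ₗ[ℝ] ℝ) (hf : ∀ i, f (b i) ≠ 0) :
    ∃ (g : SpecialLinearGroup (Fin m) ℝ) (l φ : Fin m → ℝ) (κ : ℝ), 0 < κ ∧
      (∀ i, l i ≠ 0) ∧ (∀ i, |l i| = |φ i|) ∧ (∀ i, l i * φ i = κ * f (b i)) ∧
      (∀ i, (axis i).map (mulVecLin g.1) = ℝ ∙ b i) ∧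
      (ℝ ∙ l).map (mulVecLin g.1) = ℝ ∙ (∑ i, b i) ∧
      (orthHyperplane φ).map (mulVecLin g.1) = LinearMap.ker f := by
  set W : Matrix (Fin m) (Fin m) ℝ := (of fun i => b i)ᵀ with hW
  have hdet : W.det ≠ 0 := by
    have : LinearIndependent ℝ W.col := b.linearIndependent
    exact ((isUnit_iff_isUnit_det W).mp (linearIndependent_cols_iff_isUnit.mp this)).ne_zero
  have hsq : ∀ i, 0 < √|f (b i)| := fun i => Real.sqrt_pos.mpr (abs_pos.mpr (hf i))
  -- Scaling column `i` by `r i` gives the point coordinate `1 / r i` and the form coefficient `r i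
  -- * f (b i)`. Up to a common factor their sizes agree when `|r i|` is proportional to `1 / √|f (b
  -- i)|`.
  obtain ⟨κ, r, hκ, hr, hprod⟩ := exists_prod_eq hm (inv_ne_zero hdet)
    fun i => inv_pos.mpr (hsq i)
  have hr0 : ∀ i, r i ≠ 0 := fun i => abs_pos.mp (by
    rw [hr]; exact mul_pos hκ (inv_pos.mpr (hsq i)))
  let g : SpecialLinearGroup (Fin m) ℝ := ⟨W * diagonal r, by
    rw [det_mul, det_diagonal, hprod, mul_inv_cancel₀ hdet]⟩
  have hg : ∀ u : Fin m → ℝ, g.1 *ᵥ u = ∑ i, (u i * r i) • b i := by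
    intro u
    change (W * diagonal r) *ᵥ u = _
    funext k
    rw [← mulVec_mulVec, Finset.sum_apply]
    simp only [mulVec, dotProduct, hW, transpose_apply, of_apply, Pi.smul_apply, smul_eq_mul]
    refine Finset.sum_congr rfl fun i _ => ?_
    have : ∑ j, diagonal r i j * u j = r i * u i := mulVec_diagonal r u i
    rw [this]; ring
  refine ⟨g, fun i => (r i)⁻¹, fun i => r i * f (b i) / κ ^ 2, (κ ^ 2)⁻¹, by positivity,
    fun i => inv_ne_zero (hr0 i), fun i => ?_, fun i => ?_, fun i => ?_, ?_, ?_⟩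
  · have h1 : |f (b i)| = √|f (b i)| * √|f (b i)| := (Real.mul_self_sqrt (abs_nonneg _)).symm
    have h2 := (hsq i).ne'
    rw [abs_inv, abs_div, abs_mul, hr, abs_of_pos (pow_pos hκ 2)]
    generalize √|f (b i)| = s at h1 h2 ⊢
    rw [h1]
    field_simp
  · have := hr0 i
    field_simp
  · rw [axis, Submodule.map_span, Set.image_singleton, mulVecLin_apply, hg,
      Finset.sum_eq_single i (fun j _ hj => by simp [hj]) (fun h => absurd (Finset.mem_univ i) h),
      Pi.single_eq_same, one_mul, Submodule.span_singleton_smul_eq (hr0 i).isUnit]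
  · rw [Submodule.map_span, Set.image_singleton, mulVecLin_apply, hg]
    congr 2
    exact Finset.sum_congr rfl fun i _ => by rw [inv_mul_cancel₀ (hr0 i), one_smul]
  · have hfg : ∀ u, f (g.1 *ᵥ u) = κ ^ 2 * ((fun i => r i * f (b i) / κ ^ 2) ⬝ᵥ u) := by
      intro u
      rw [hg, map_sum, dotProduct, Finset.mul_sum]
      refine Finset.sum_congr rfl fun i _ => ?_
      rw [map_smul, smul_eq_mul]
      field_simp
    have hκ2 : κ ^ 2 ≠ 0 := (pow_pos hκ 2).ne'
    ext v
    rw [Submodule.mem_map, LinearMap.mem_ker]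
    constructor
    · rintro ⟨u, hu, rfl⟩
      rw [mulVecLin_apply, hfg, mem_orthHyperplane.mp hu, mul_zero]
    · intro hv
      have hgv : g.1 *ᵥ ((g⁻¹).1 *ᵥ v) = v := by rw [mulVec_mulVec, coe_mul_coe_inv, one_mulVec]
      refine ⟨(g⁻¹).1 *ᵥ v, ?_, hgv⟩
      rw [← hgv, hfg] at hv
      exact (mul_eq_zero.mp hv).resolve_left hκ2

theorem exists_functional_ker_eq {P : Submodule ℝ (Fin m → ℝ)} (hP : Module.finrank ℝ P + 1 = m) :
    ∃ f : (Fin m → ℝ) →ₗ[ℝ] ℝ, LinearMap.ker f = P := by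
  have hlt : P < ⊤ := by
    refine lt_top_iff_ne_top.mpr fun h => ?_
    rw [h, finrank_top, Module.finrank_fin_fun] at hP
    omega
  obtain ⟨f, hf0, hf⟩ := P.exists_le_ker_of_lt_top hlt
  refine ⟨f, (Submodule.eq_of_le_of_finrank_eq hf ?_).symm⟩
  have := Module.Dual.finrank_ker_add_one_of_ne_zero hf0
  rw [Module.finrank_fin_fun] at this
  omega

end SLSymm

/-! ### Reduction of the proposition to the normal form. -/

theorem mainTheorem4 (m : ℕ) (hm : 2 ≤ m)
    (Ls : Fin m → ℙ ℝ (Fin m → ℝ)) (L : ℙ ℝ (Fin m → ℝ)) (P : Submodule ℝ (Fin m → ℝ))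
    (hP : Module.finrank ℝ P + 1 = m)
    (hgen : SLSymm.GeneralPosition Ls L P) :
    (∀ x ∈ SLSymm.faceComplement Ls,
      SLSymm.IsOpenSimplex Ls (connectedComponentIn (SLSymm.faceComplement Ls) x)) ∧
    Disjoint (SLSymm.sphereAtInfinity fun i => (Ls i).submodule)
      (SLSymm.sphereAtInfinity ![L.submodule, P]) ∧
    (SLSymm.Links (SLSymm.sphereAtInfinity fun i => (Ls i).submodule)
        (SLSymm.sphereAtInfinity ![L.submodule, P]) ↔
      Disjoint (connectedComponentIn (SLSymm.faceComplement Ls) L) (SLSymm.projPoints P)) ∧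
    (SLSymm.Links (SLSymm.sphereAtInfinity ![L.submodule, P])
        (SLSymm.sphereAtInfinity fun i => (Ls i).submodule) ↔
      Disjoint (connectedComponentIn (SLSymm.faceComplement Ls) L) (SLSymm.projPoints P)) := by
  have hm0 : 0 < m := by omega
  obtain ⟨b₀, hb₀⟩ := SLSymm.exists_basis_of_independent hgen.independent
  refine ⟨fun x hx => ?_, ?_⟩
  · obtain ⟨b, hb, hbx⟩ := SLSymm.exists_adapted_basis b₀ hb₀ hx
    refine ⟨b, b.linearIndependent, fun i => ?_, ?_⟩
    · rw [hb]; exact Submodule.mem_span_singleton_self _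
    · refine SLSymm.connectedComponentIn_faceComplement b hm0 hb ?_
      rw [hbx, Projectivization.submodule_eq]
      exact Submodule.mem_span_singleton_self _
  have hL : L ∈ SLSymm.faceComplement Ls := by
    rw [SLSymm.faceComplement, Set.mem_compl_iff, Set.mem_iUnion]
    exact fun ⟨i, hi⟩ => hgen.notMem_face i hi
  obtain ⟨b, hb, hbL⟩ := SLSymm.exists_adapted_basis b₀ hb₀ hL
  have hLb : L.submodule = ℝ ∙ ∑ i, b i := by rw [hbL, Projectivization.submodule_eq]
  obtain ⟨f, hf⟩ := SLSymm.exists_functional_ker_eq hP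
  have hfb : ∀ i, f (b i) ≠ 0 := fun i h => hgen.vertex_notMem i (by
    rw [SLSymm.projPoints, Set.mem_ofPred_eq, hb, Submodule.span_singleton_le_iff_mem, ← hf]
    exact h)
  obtain ⟨g, l, φ, κ, hκ, hl, habs, hsign, hax, hgl, hgP⟩ :=
    SLSymm.exists_adapted_translate hm0 b f hfb
  have hA : (SLSymm.sphereAtInfinity fun i => (Ls i).submodule) =
      SLSymm.translateHomeo g '' SLSymm.sphereAtInfinity SLSymm.axis := by
    rw [← SLSymm.sphereAtInfinity_map]
    congr 1
    funext i
    rw [hb, hax]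
  have hB : SLSymm.sphereAtInfinity ![L.submodule, P] =
      SLSymm.translateHomeo g '' SLSymm.sphereAtInfinity ![ℝ ∙ l, SLSymm.orthHyperplane φ] := by
    rw [← SLSymm.sphereAtInfinity_map]
    congr 1
    funext i
    fin_cases i
    · exact hLb.trans hgl.symm
    · exact hf.symm.trans hgP.symm
  -- The simplex meets `P` exactly when `f` has a zero with positive coordinates in `b`, and `l i *
  -- φ i` has the sign of `f (b i)`.
  have hD : Disjoint (connectedComponentIn (SLSymm.faceComplement Ls) L) (SLSymm.projPoints P) ↔
      (∀ i, 0 < l i * φ i) ∨ ∀ i, l i * φ i < 0 := by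
    have h1 : ∀ i, 0 < l i * φ i ↔ 0 < f (b i) := fun i => by
      rw [hsign, mul_pos_iff_of_pos_left hκ]
    have h2 : ∀ i, l i * φ i < 0 ↔ f (b i) < 0 := fun i => by
      rw [hsign, ← neg_pos, ← mul_neg, mul_pos_iff_of_pos_left hκ, neg_pos]
    simp only [h1, h2]
    rw [← SLSymm.no_positive_zero_iff hm0 hfb, SLSymm.connectedComponentIn_faceComplement b hm0 hb
      (hLb ▸ Submodule.mem_span_singleton_self _), Set.disjoint_left]
    have hfs : ∀ c : Fin m → ℝ, f (∑ i, c i • b i) = ∑ i, c i * f (b i) := fun c => by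
      simp only [map_sum, map_smul, smul_eq_mul]
    constructor
    · intro h c hc h0
      have hne : ∑ i, c i • b i ≠ 0 := by
        intro h0'
        have := congrArg (fun u => b.repr u ⟨0, hm0⟩) h0'
        simp only [b.repr_sum_self, map_zero, Finsupp.zero_apply] at this
        exact (hc _).ne' this
      refine h (a := Projectivization.mk ℝ _ hne) ⟨c, hc, ?_⟩ ?_
      · rw [Projectivization.submodule_mk]; exact Submodule.mem_span_singleton_self _
      · rw [SLSymm.projPoints, Set.mem_ofPred_eq, Projectivization.submodule_mk,
          Submodule.span_singleton_le_iff_mem, ← hf, LinearMap.mem_ker, hfs, h0]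
    · rintro h x ⟨c, hc, hx⟩ hxP
      have : ∑ i, c i • b i ∈ LinearMap.ker f := hf ▸ hxP hx
      exact h c hc (by rw [← hfs]; exact this)
  have hnf := SLSymm.links_normal_form hm0 hl habs
  rw [hA, hB, hD, SLSymm.links_image_iff, SLSymm.links_image_iff]
  exact ⟨(Set.disjoint_image_iff (SLSymm.translateHomeo g).injective).mpr
    (SLSymm.disjoint_spheres hl hm0 habs), hnf.1, hnf.2⟩
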